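/- Let $\lambda>0$, $b>0$, $s\in\mathbb R$, put $t^\ast=b/\lambda$ and let $T\ge t^\ast$. Let $\rho_0\in L^1(0,b)$. **Supply.** For an inflow $u$, let $\rho$ be the weak solution on $[0,b]\times[0,T]$ of the scalar linear advection equation with linear source $$\partial_t\rho+\lambda\,\partial_x\rho=s\rho,\qquad \rho(x,0)=\rho_0(x),\qquad \rho(0,t)=u(t),$$ and let $S_u(t)=\rho(b,t)$ be its outflow trace at $x=b$ (determined up to null sets of times; a representative may be chosen). The transport delay is $b/\lambda$ (equal to $1/\lambda$ for an edge of length $b=1$). Admissible controls are the deterministic functions $u\in L^2([0,T])$ with $u(t)\ge 0$ on $[0,T]$. **Demand.** Let $W$ be a Brownian motion on a probability space, $\kappa,\sigma>0$, $y_0\in\mathbb R$, $\mu\in L^1(0,T)$, and let $Y$ be the Ornstein–Uhlenbeck process $$dY_t=\kappa(\mu(t)-Y_t)\,dt+\sigma\,dW_t,\qquad Y_0=y_0 .$$ Put $$m_{OUP}(t)=y_0e^{-\kappa t}+\kappa\int_0^t e^{-\kappa(t-r)}\mu(r)\,dr,\qquad v_{OUP}(t)=\frac{\sigma^2}{2\kappa}\bigl(1-e^{-2\kappa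 t}\bigr)$$ (the mean and the variance of $Y_t$) and, for a risk level $\theta\in(0,1/2]$, $$q(t)=m_{OUP}(t)+\sqrt{v_{OUP}(t)}\;\Phi^{-1}(1-\theta),$$ where $\Phi$ is the standard normal distribution function. Assume $q(t)\ge 0$ for all $t\in[t^\ast,T]$. **Optimal control problem.** Minimize the pure tracking cost $$\int_{t^\ast}^{T}\mathbb E\bigl[(S_u(t)-Y_t)^2\bigr]\,dt$$ over the admissible controls $u$, subject to the single chance constraint $$P\bigl(Y_t\le S_u(t)\bigr)\ge 1-\theta\qquad\text{for all } t\in I_{CC},$$ which is active at all times that the inflow can influence: $[t^\ast,T]\subseteq I_{CC}\subseteq[0,T]$. If $I_{CC}$ also contains times $t<t^\ast$ (for example, if $I_{CC}=[0,T]$), assume that the outflow of the initial state meets the constraint there, i.e. $P\bigl(Y_t\le e^{st}\rho_0(b-\lambda t)\bigr)\ge 1-\theta$ for almost every $t\in I_{CC}$ with $t<t^\ast$; for $I_{CC}=[t^\ast,T]$ nothing is assumed. **Theorem.** There is an optimal control $u^\ast$ with $$u^\ast(t)=e^{-sb/\lambda}\Bigl(m_{OUP}\bigl(t+\tfrac b\lambda\bigr)+\sqrt{v_{OUP}\bigl(t+\tfrac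 b\lambda\bigr)}\;\Phi^{-1}(1-\theta)\Bigr)\qquad\text{for all } t\in\bigl[0,T-\tfrac b\lambda\bigr].$$ Moreover, a control is optimal if and only if it is admissible and equals this expression for almost every $t\in[0,T-b/\lambda]$. -/

import Mathlib

open MeasureTheory ProbabilityTheory Set
open scoped NNReal ENNReal

noncomputable section

namespace SupplyControl

/-- Weak solution, with outflow trace, of the scalar linear advection equation with linear source
`∂ₜ ρ + lam ∂ₓ ρ = s ρ` on the edge `[0, b]` and the time interval `[0, T]`, with
`ρ(x, 0) = ρ₀ x` and inflow `ρ(0, t) = u t`. Points of the plane are pairs `(x, t)`.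
The function `S` is the boundary trace `S t = ρ(b, t)` at the outflow end `x = b`; it enters
through the boundary term of the integration by parts. The test functions are smooth, compactly
supported in the plane, and supported in times `t < T`; at `t = 0`, `x = 0` and `x = b` they are
unrestricted. -/
structure IsWeakSolution (lam s b T : ℝ) (ρ₀ u : ℝ → ℝ) (ρ : ℝ × ℝ → ℝ) (S : ℝ → ℝ) : Prop where
  integrableOn_density : IntegrableOn ρ (Icc 0 b ×ˢ Icc 0 T)
  integrableOn_outflow : IntegrableOn S (Icc 0 T)
  weak_form : ∀ φ : ℝ × ℝ → ℝ, ContDiff ℝ (⊤ : ℕ∞) φ → HasCompactSupport φ →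
    tsupport φ ⊆ {p : ℝ × ℝ | p.2 < T} →
    (∫ p in Icc (0 : ℝ) b ×ˢ Icc (0 : ℝ) T,
        ρ p * (fderiv ℝ φ p (0, 1) + lam * fderiv ℝ φ p (1, 0) + s * φ p))
      + (∫ x in Icc 0 b, ρ₀ x * φ (x, 0))
      + lam * (∫ t in Icc 0 T, u t * φ (0, t))
      - lam * (∫ t in Icc 0 T, S t * φ (b, t)) = 0

/-- `S` is the supply `t ↦ ρ(b, t)` at the demand node produced by the inflow `u`. -/
def IsSupply (lam s b T : ℝ) (ρ₀ u S : ℝ → ℝ) : Prop :=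
  ∃ ρ : ℝ × ℝ → ℝ, IsWeakSolution lam s b T ρ₀ u ρ S

/-- Admissible controls: nonnegative, square-integrable, deterministic inflows on `[0, T]`. -/
structure IsAdmissible (T : ℝ) (u : ℝ → ℝ) : Prop where
  memLp : MemLp u 2 (volume.restrict (Icc 0 T))
  nonneg : ∀ t ∈ Icc 0 T, 0 ≤ u t

/-- `Y` is, on `[0, T]`, a time-inhomogeneous Ornstein–Uhlenbeck process, that is, a continuous
solution of `dY = κ (μ t - Y) dt + σ dW`, `Y 0 = y₀`. As the noise is additive, the stochastic
integral of the constant `σ` is `σ (W t - W 0) = σ W t`. -/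
structure IsOUProcess {Ω : Type*} [MeasurableSpace Ω] (P : Measure Ω) (W : ℝ≥0 → Ω → ℝ)
    (κ σ y₀ : ℝ) (μ : ℝ → ℝ) (T : ℝ) (Y : ℝ → Ω → ℝ) : Prop where
  aemeasurable : ∀ t ∈ Icc 0 T, AEMeasurable (Y t) P
  continuousOn_path : ∀ᵐ w ∂P, ContinuousOn (fun t => Y t w) (Icc 0 T)
  integral_eq : ∀ᵐ w ∂P, ∀ t ∈ Icc 0 T,
    Y t w = y₀ + (∫ r in (0 : ℝ)..t, κ * (μ r - Y r w)) + σ * W t.toNNReal w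

/-- Mean of the Ornstein–Uhlenbeck process at time `t`. -/
def meanOUP (κ y₀ : ℝ) (μ : ℝ → ℝ) (t : ℝ) : ℝ :=
  y₀ * Real.exp (-κ * t) + κ * ∫ r in (0 : ℝ)..t, Real.exp (-κ * (t - r)) * μ r

/-- Variance of the Ornstein–Uhlenbeck process at time `t`. -/
def varOUP (κ σ t : ℝ) : ℝ :=
  σ ^ 2 / (2 * κ) * (1 - Real.exp (-2 * κ * t))

/-- The quantile function `Φ⁻¹` of the standard normal distribution (for `0 < p < 1`). -/
def stdNormalQuantile (p : ℝ) : ℝ :=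
  sInf {z : ℝ | p ≤ cdf (gaussianReal 0 1) z}

/-- The pointwise normal-quantile bound at risk level `θ`: mean plus standard deviation times
`Φ⁻¹(1 - θ)`. -/
def quantileBound (κ σ y₀ : ℝ) (μ : ℝ → ℝ) (θ t : ℝ) : ℝ :=
  meanOUP κ y₀ μ t + Real.sqrt (varOUP κ σ t) * stdNormalQuantile (1 - θ)

/-- The single chance constraint on `I`: at each time in `I`, the demand is satisfied with
probability at least `1 - θ`. -/
def SingleChanceConstraint {Ω : Type*} [MeasurableSpace Ω] (P : Measure Ω) (Y : ℝ → Ω → ℝ)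
    (θ : ℝ) (I : Set ℝ) (S : ℝ → ℝ) : Prop :=
  ∀ t ∈ I, ENNReal.ofReal (1 - θ) ≤ P {w | Y t w ≤ S t}

/-- Pure tracking cost `∫_{t₁}^{T} 𝔼[(S t - Y t)²] dt`, as an element of `[0, ∞]`. -/
def trackingCost {Ω : Type*} [MeasurableSpace Ω] (P : Measure Ω) (Y : ℝ → Ω → ℝ)
    (t₁ T : ℝ) (S : ℝ → ℝ) : ℝ≥0∞ :=
  ∫⁻ t in Icc t₁ T, ∫⁻ w, ENNReal.ofReal ((S t - Y t w) ^ 2) ∂P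

/-- The constraints of the control problem: `u` is admissible, `S` is the supply produced by `u`,
and `S` satisfies the single chance constraint on `I`. -/
structure IsFeasible {Ω : Type*} [MeasurableSpace Ω] (P : Measure Ω) (Y : ℝ → Ω → ℝ)
    (lam s b T : ℝ) (ρ₀ : ℝ → ℝ) (θ : ℝ) (I : Set ℝ) (u S : ℝ → ℝ) : Prop where
  admissible : IsAdmissible T u
  supply : IsSupply lam s b T ρ₀ u S
  chance : SingleChanceConstraint P Y θ I S

/-- `u` is an optimal control: it is feasible and its tracking cost over `[b / lam, T]`
is minimal among all feasible controls. Here `b / lam` is the first time at which the inflow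
reaches the demand node. -/
def IsOptimalControl {Ω : Type*} [MeasurableSpace Ω] (P : Measure Ω) (Y : ℝ → Ω → ℝ)
    (lam s b T : ℝ) (ρ₀ : ℝ → ℝ) (θ : ℝ) (I : Set ℝ) (u : ℝ → ℝ) : Prop :=
  ∃ S : ℝ → ℝ, IsFeasible P Y lam s b T ρ₀ θ I u S ∧
    ∀ u' S' : ℝ → ℝ, IsFeasible P Y lam s b T ρ₀ θ I u' S' →
      trackingCost P Y (b / lam) T S ≤ trackingCost P Y (b / lam) T S'

/-- The closed-form control: the quantile bound one transport delay `b / lam` ahead, divided by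
the factor `exp (s b / lam)` that the source term applies along the edge. -/
def optimalInflow (lam s b κ σ y₀ : ℝ) (μ : ℝ → ℝ) (θ t : ℝ) : ℝ :=
  Real.exp (-(s * b / lam)) * quantileBound κ σ y₀ μ θ (t + b / lam)

end SupplyControl

end

/-! ### Gaussian quantiles and second moments. -/

namespace SupplyControl

open Filter Topology

/-! Variation of constants shows that `Y t` is Gaussian with mean `meanOUP` and variance `varOUP`
(`IsOUProcess.hasLaw`). At a time `t > 0` the chance constraint therefore reads `S t ≥ q t`, with
`q` the `quantileBound` (`chance_iff`), and the cost is the integral of `varOUP + (S - meanOUP) ^ 2`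
(`trackingCost_eq`). Since `θ ≤ 1/2`, `q` lies above the mean, on the increasing branch of the
parabola, so `S = q` minimizes the integrand at every time. Its cost is finite, so any other
minimizer agrees with `q` almost everywhere (`ae_eq_quantileBound_of_trackingCost_le`).

It remains to translate outflow into inflow: from time `b / lam` on, the trace is the inflow delayed
by `b / lam` and multiplied by `exp (s b / lam)`. Two facts are needed. The formula given by
characteristics is a weak solution (`isWeakSolution_characteristic`), which makes the closed form
feasible; and the trace of every weak solution obeys the delay formula
(`IsWeakSolution.outflow_ae_eq`, by duality), which makes it unique. The trace is determined only up
to null sets while the constraint holds at every time, so `exists_isFeasible` chooses a suitable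
representative. -/

theorem bddBelow_setOf_le_cdf {p : ℝ} (hp : 0 < p) (ν : Measure ℝ) :
    BddBelow {z : ℝ | p ≤ cdf ν z} := by
  obtain ⟨a, ha⟩ := ((tendsto_cdf_atBot ν).eventually (gt_mem_nhds hp)).exists
  refine ⟨a, fun z hz => ?_⟩
  by_contra h
  exact absurd (hz.trans (monotone_cdf ν (not_le.1 h).le)) (not_le.2 ha)

theorem nonempty_setOf_le_cdf {p : ℝ} (hp : p < 1) (ν : Measure ℝ) :
    {z : ℝ | p ≤ cdf ν z}.Nonempty :=
  let ⟨a, ha⟩ := ((tendsto_cdf_atTop ν).eventually (lt_mem_nhds hp)).exists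
  ⟨a, le_of_lt ha⟩

/-- Points to the right of the infimum lie above a member of the set, so they belong to it by
monotonicity; right continuity of the cdf passes this to the infimum. -/
theorem le_cdf_sInf {p : ℝ} (hp : p < 1) (ν : Measure ℝ) :
    p ≤ cdf ν (sInf {z : ℝ | p ≤ cdf ν z}) := by
  set c := sInf {z : ℝ | p ≤ cdf ν z}
  have hc : Tendsto (cdf ν) (𝓝[>] c) (𝓝 (cdf ν c)) :=
    ((cdf ν).right_continuous c).mono_left (nhdsWithin_mono _ Ioi_subset_Ici_self)
  refine ge_of_tendsto hc ?_
  filter_upwards [self_mem_nhdsWithin] with z hz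
  obtain ⟨y, hy, hyz⟩ := exists_lt_of_csInf_lt (nonempty_setOf_le_cdf hp ν) hz
  exact le_trans hy (monotone_cdf ν hyz.le)

/-- By symmetry `Iic z` and `Ici (-z)` carry equal mass, and the gap between them has positive mass
because Lebesgue measure is absolutely continuous with respect to the Gaussian. -/
theorem cdf_gaussianReal_lt_half {z : ℝ} (hz : z < 0) : cdf (gaussianReal 0 1) z < 1 / 2 := by
  rw [cdf_eq_real]
  set ν := gaussianReal 0 1
  have hsymm : ν.real (Ici (-z)) = ν.real (Iic z) := by
    have h : ν.map (fun x => -x) = ν := by simp [ν, gaussianReal_map_neg]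
    conv_lhs => rw [← h]
    rw [map_measureReal_apply measurable_neg measurableSet_Ici]
    congr 1
    ext x; simp
  have hpos : 0 < ν.real (Ioo z (-z)) := by
    refine ENNReal.toReal_pos (fun h => ?_) (measure_ne_top _ _)
    have := gaussianReal_absolutelyContinuous' 0 one_ne_zero h
    simp at this
    linarith
  have h1 : ν.real (Iic z ∪ Ioo z (-z)) = ν.real (Iic z) + ν.real (Ioo z (-z)) :=
    measureReal_union (disjoint_left.2 fun x hx hy => not_lt.2 hx hy.1) measurableSet_Ioo
  have h2 : ν.real ((Iic z ∪ Ioo z (-z)) ∪ Ici (-z))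
      = ν.real (Iic z ∪ Ioo z (-z)) + ν.real (Ici (-z)) := by
    refine measureReal_union (disjoint_left.2 fun x hx hy => ?_) measurableSet_Ici
    simp only [mem_union, mem_Iic, mem_Ioo, mem_Ici] at hx hy
    rcases hx with hx | hx <;> linarith [hx, hy]
  have h3 : ν.real ((Iic z ∪ Ioo z (-z)) ∪ Ici (-z)) ≤ 1 := measureReal_le_one
  linarith

theorem stdNormalQuantile_nonneg {p : ℝ} (hp : 1 / 2 ≤ p) (hp1 : p < 1) :
    0 ≤ stdNormalQuantile p := by
  refine le_csInf (nonempty_setOf_le_cdf hp1 _) fun z hz => ?_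
  by_contra h
  exact absurd (hp.trans hz) (not_le.2 (cdf_gaussianReal_lt_half (not_le.1 h)))

theorem stdNormalQuantile_le_iff {p : ℝ} (hp : 0 < p) (hp1 : p < 1) (z : ℝ) :
    stdNormalQuantile p ≤ z ↔ p ≤ cdf (gaussianReal 0 1) z :=
  ⟨fun h => (le_cdf_sInf hp1 _).trans (monotone_cdf _ h),
    fun h => csInf_le (bddBelow_setOf_le_cdf hp _) h⟩

/-- A Gaussian variable stays below `c` with probability at least `p` iff `c` is at least its
`p`-quantile. -/
theorem ofReal_le_measure_le_iff {Ω : Type*} [MeasurableSpace Ω] {P : Measure Ω} {X : Ω → ℝ}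
    {m v : ℝ} (hv : 0 < v) (hX : HasLaw X (gaussianReal m v.toNNReal) P) {p : ℝ}
    (hp : 0 < p) (hp1 : p < 1) (c : ℝ) :
    ENNReal.ofReal p ≤ P {w | X w ≤ c} ↔ m + √v * stdNormalQuantile p ≤ c := by
  have hs : 0 < √v := Real.sqrt_pos.2 hv
  have h1 : P {w | X w ≤ c} = gaussianReal m v.toNNReal (Iic c) := by
    rw [← hX.map_eq, Measure.map_apply_of_aemeasurable hX.aemeasurable measurableSet_Iic]
    rfl
  have h2 : gaussianReal m v.toNNReal = (gaussianReal 0 1).map (fun x => m + √v * x) := by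
    have h := gaussianReal_map_const_mul (μ := 0) (v := 1) √v
    have h' := gaussianReal_map_const_add (μ := √v * 0) (v := NNReal.mk (√v ^ 2) (sq_nonneg _) * 1) m
    rw [← h, Measure.map_map (by fun_prop) (by fun_prop)] at h'
    convert! h'.symm using 2
    · simp
    · ext; simp [Real.sq_sqrt hv.le, hv.le]
  rw [h1, h2, Measure.map_apply (by fun_prop) measurableSet_Iic]
  have h3 : (fun x => m + √v * x) ⁻¹' Iic c = Iic ((c - m) / √v) := by
    ext x
    simp only [mem_preimage, mem_Iic, le_div_iff₀ hs]
    constructor <;> intro h <;> linarith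
  rw [h3, ← ofReal_cdf, ENNReal.ofReal_le_ofReal_iff (cdf_nonneg _ _),
    ← stdNormalQuantile_le_iff hp hp1, le_div_iff₀ hs]
  constructor <;> intro h <;> linarith

/-- Bias–variance decomposition. -/
theorem lintegral_sq_sub_gaussian {Ω : Type*} [MeasurableSpace Ω] {P : Measure Ω}
    [IsProbabilityMeasure P] {X : Ω → ℝ}
    {m v : ℝ} (hv : 0 < v) (hX : HasLaw X (gaussianReal m v.toNNReal) P) (c : ℝ) :
    ∫⁻ w, ENNReal.ofReal ((c - X w) ^ 2) ∂P = ENNReal.ofReal (v + (c - m) ^ 2) := by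
  have hL : MemLp X 2 P := hX.hasGaussianLaw.memLp_two
  have hint : P[X] = m := by rw [hX.integral_eq, integral_id_gaussianReal]
  have hvar : Var[X; P] = v := by
    rw [hX.variance_eq, variance_id_gaussianReal]; simp [hv.le]
  have hi := hL.integrable one_le_two
  have hsq := hL.integrable_sq
  have e : ∀ w, (c - X w) ^ 2 = c ^ 2 - 2 * c * X w + X w ^ 2 := fun w => by ring
  have hI : Integrable (fun w => (c - X w) ^ 2) P := by
    simp only [e]
    exact ((integrable_const _).sub (hi.const_mul _)).add hsq
  rw [← ofReal_integral_eq_lintegral_ofReal hI (ae_of_all _ fun _ => sq_nonneg _)]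
  congr 1
  rw [variance_eq_sub hL] at hvar
  simp only [e]
  rw [integral_add (f := fun w => c ^ 2 - 2 * c * X w)
      ((integrable_const _).sub (hi.const_mul _)) hsq,
    integral_sub (integrable_const _) (hi.const_mul _), integral_const_mul, hint]
  simp only [Pi.pow_apply] at hvar
  rw [hint] at hvar
  simp
  linarith

end SupplyControl

/-! ### Gaussian marginals of the Ornstein–Uhlenbeck process. -/

namespace SupplyControl

open Filter Topology

theorem hasDerivAt_exp_decay (κ t r : ℝ) :
    HasDerivAt (fun r => Real.exp (-κ * (t - r))) (κ * Real.exp (-κ * (t - r))) r := by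
  have h : HasDerivAt (fun r : ℝ => -κ * (t - r)) κ r := by
    simpa using ((hasDerivAt_id r).const_sub t).const_mul (-κ)
  convert! h.exp using 1
  ring

/-- Variation of constants for the integral equation `y = y₀ + ∫ κ (μ - y) + σ w`. -/
theorem eq_meanOUP_add {κ σ y₀ t : ℝ} {μ y w : ℝ → ℝ} (ht : 0 ≤ t)
    (hμ : IntegrableOn μ (Icc 0 t)) (hy : ContinuousOn y (Icc 0 t)) (hw : ContinuousOn w (Icc 0 t))
    (h : ∀ x ∈ Icc 0 t, y x = y₀ + (∫ r in (0 : ℝ)..x, κ * (μ r - y r)) + σ * w x) :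
    y t = meanOUP κ y₀ μ t
      + σ * (w t - κ * ∫ r in (0 : ℝ)..t, Real.exp (-κ * (t - r)) * w r) := by
  have hu : uIcc 0 t = Icc 0 t := uIcc_of_le ht
  set f : ℝ → ℝ := fun r => Real.exp (-κ * (t - r)) with hf
  set g : ℝ → ℝ := fun r => κ * (μ r - y r) with hg
  have hfd : deriv f = fun r => κ * f r := funext fun r => (hasDerivAt_exp_decay κ t r).deriv
  have hfc : Continuous f := by fun_prop
  have hμi : IntervalIntegrable μ volume 0 t :=
    (intervalIntegrable_iff_integrableOn_Icc_of_le ht).2 hμ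
  have hyi : IntervalIntegrable y volume 0 t := (hu ▸ hy).intervalIntegrable
  have hwi : IntervalIntegrable w volume 0 t := (hu ▸ hw).intervalIntegrable
  have hgi : IntervalIntegrable g volume 0 t := (hμi.sub hyi).const_mul κ
  have hfa : AbsolutelyContinuousOnInterval f 0 t := by
    apply ContDiffOn.absolutelyContinuousOnInterval
    fun_prop
  -- As `μ` is merely integrable, the primitive of `g` is only absolutely continuous, and
  -- integration by parts is used in that class.
  have hparts := hfa.integral_deriv_mul_eq_sub
    (hgi.absolutelyContinuousOnInterval_intervalIntegral (c := 0) (by simp))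
  have hft : f t = 1 := by simp [hf]
  -- The unknown `y` cancels between `f' = κ f` times the primitive and `f` times `g`; only the data
  -- `μ`, `y₀`, `w` remain.
  have hint : ∫ x in (0 : ℝ)..t, (deriv f x * (∫ r in (0 : ℝ)..x, g r)
        + f x * deriv (fun x => ∫ r in (0 : ℝ)..x, g r) x)
      = ∫ x in (0 : ℝ)..t, (κ * (f x * μ x) - y₀ * (κ * f x) - σ * κ * (f x * w x)) := by
    refine intervalIntegral.integral_congr_ae ?_
    filter_upwards [hgi.ae_hasDerivAt_integral] with x hx hxt
    have hx' := uIoc_subset_uIcc hxt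
    rw [(hx hx' 0 (by simp)).deriv, hfd]
    have h1 := h x (hu ▸ hx')
    have h2 : (∫ r in (0 : ℝ)..x, g r) = y x - y₀ - σ * w x := by
      rw [h1]; ring
    rw [h2]
    simp only [hg]
    ring
  have hfμ := hμi.continuousOn_mul hfc.continuousOn
  have hfw := hwi.continuousOn_mul hfc.continuousOn
  have hfi : IntervalIntegrable (fun x => κ * f x) volume 0 t :=
    (by fun_prop : Continuous fun x => κ * f x).intervalIntegrable _ _
  have hexp : ∫ x in (0 : ℝ)..t, κ * f x = 1 - f 0 := by
    rw [intervalIntegral.integral_eq_sub_of_hasDerivAt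
      (fun x _ => hasDerivAt_exp_decay κ t x) hfi]
    simp [hf]
  rw [intervalIntegral.integral_const_mul] at hexp
  rw [hint, intervalIntegral.integral_sub ((hfμ.const_mul κ).sub (hfi.const_mul y₀))
      (hfw.const_mul _), intervalIntegral.integral_sub (hfμ.const_mul κ) (hfi.const_mul y₀),
    intervalIntegral.integral_const_mul, intervalIntegral.integral_const_mul,
    intervalIntegral.integral_const_mul, intervalIntegral.integral_const_mul, hexp, intervalIntegral.integral_same, hft] at hparts
  have h0 : f 0 = Real.exp (-κ * t) := by simp [hf]
  rw [h t ⟨ht, le_rfl⟩, meanOUP, ← h0]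
  linear_combination -hparts

/-- Riemann–Stieltjes sums of a `C¹` integrand against a continuous integrator converge. -/
theorem tendsto_sum_mul_sub {f f' w : ℝ → ℝ} (hf : ∀ x, HasDerivAt f (f' x) x)
    (hf' : Continuous f') (hw : Continuous w) {t : ℝ} (ht : 0 ≤ t) :
    Tendsto (fun n : ℕ => ∑ i ∈ Finset.range n,
        f (i * (t / n)) * (w ((i + 1 : ℕ) * (t / n)) - w (i * (t / n)))) atTop
      (𝓝 (f t * w t - f 0 * w 0 - ∫ r in (0 : ℝ)..t, f' r * w r)) := by
  obtain ⟨C, hC⟩ := (isCompact_Icc (a := (0 : ℝ)) (b := t)).exists_bound_of_continuousOn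
    hf'.continuousOn
  have hC0 : 0 ≤ C := (norm_nonneg _).trans (hC 0 ⟨le_rfl, ht⟩)
  have huc := (isCompact_Icc (a := (0 : ℝ)) (b := t)).uniformContinuousOn_of_continuous
    hw.continuousOn
  rw [Metric.tendsto_atTop]
  intro ε hε
  -- The total error will be at most `C * t * η`; the `+ 1` makes this strictly less than `ε` and
  -- covers `C * t = 0`.
  set η := ε / (C * t + 1) with hη
  have hCt : 0 < C * t + 1 := by positivity
  have hη0 : 0 < η := by positivity
  obtain ⟨δ, hδ, hδw⟩ := Metric.uniformContinuousOn_iff.1 huc η hη0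
  obtain ⟨N, hN⟩ := exists_nat_gt (t / δ)
  refine ⟨N + 1, fun n hn => ?_⟩
  have hn0 : (0 : ℝ) < n := by exact_mod_cast (by omega : 0 < n)
  have hNn : (N : ℝ) < n := by exact_mod_cast (by omega : N < n)
  set d := t / n with hd
  have hd0 : 0 ≤ d := by positivity
  have hdδ : d < δ := by
    rw [hd, div_lt_iff₀ hn0]
    rw [div_lt_iff₀ hδ] at hN
    nlinarith
  have hnd : (n : ℝ) * d = t := by rw [hd]; field_simp
  have hI : ∀ a b, IntervalIntegrable (fun r => f' r * w r) volume a b :=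
    fun a b => (hf'.mul hw).intervalIntegrable _ _
  have hsum : ∑ i ∈ Finset.range n, ∫ r in (i * d)..((i + 1 : ℕ) * d), f' r * w r
      = ∫ r in (0 : ℝ)..t, f' r * w r := by
    have := intervalIntegral.sum_integral_adjacent_intervals (f := fun r => f' r * w r)
      (a := fun i : ℕ => (i : ℝ) * d) (n := n) (μ := volume) (fun k _ => hI _ _)
    simpa [hnd] using this
  have htel : ∑ i ∈ Finset.range n, (f ((i + 1 : ℕ) * d) * w ((i + 1 : ℕ) * d)
      - f (i * d) * w (i * d)) = f t * w t - f 0 * w 0 := by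
    have := Finset.sum_range_sub (fun i : ℕ => f (i * d) * w (i * d)) n
    simpa [hnd] using this
  rw [dist_eq_norm, ← htel, ← hsum, ← Finset.sum_sub_distrib, ← Finset.sum_sub_distrib]
  have hterm : ∀ i ∈ Finset.range n,
      ‖f (i * d) * (w ((i + 1 : ℕ) * d) - w (i * d))
        - (f ((i + 1 : ℕ) * d) * w ((i + 1 : ℕ) * d) - f (i * d) * w (i * d)
          - ∫ r in (i * d)..((i + 1 : ℕ) * d), f' r * w r)‖ ≤ C * η * d := by
    intro i hi
    have hin : ((i + 1 : ℕ) : ℝ) ≤ n := by exact_mod_cast Finset.mem_range.1 hi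
    have hid : (i : ℝ) * d ≤ (i + 1 : ℕ) * d := by
      push_cast; nlinarith
    have hid0 : 0 ≤ (i : ℝ) * d := by positivity
    have hidt : ((i + 1 : ℕ) : ℝ) * d ≤ t := by
      rw [← hnd]; exact mul_le_mul_of_nonneg_right hin hd0
    have hlen : ((i + 1 : ℕ) : ℝ) * d - i * d = d := by push_cast; ring
    have e1 : f ((i + 1 : ℕ) * d) - f (i * d) = ∫ r in (i * d)..((i + 1 : ℕ) * d), f' r :=
      (intervalIntegral.integral_eq_sub_of_hasDerivAt (fun x _ => hf x)
        (hf'.intervalIntegrable _ _)).symm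
    -- Integration by parts on one cell: the error only sees the oscillation of `w` there.
    have e2 : f (i * d) * (w ((i + 1 : ℕ) * d) - w (i * d))
        - (f ((i + 1 : ℕ) * d) * w ((i + 1 : ℕ) * d) - f (i * d) * w (i * d)
          - ∫ r in (i * d)..((i + 1 : ℕ) * d), f' r * w r)
        = ∫ r in (i * d)..((i + 1 : ℕ) * d), f' r * (w r - w ((i + 1 : ℕ) * d)) := by
      have hc : IntervalIntegrable (fun r => f' r * w ((i + 1 : ℕ) * d)) volume (i * d)
          ((i + 1 : ℕ) * d) := (hf'.mul continuous_const).intervalIntegrable _ _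
      simp only [mul_sub]
      rw [intervalIntegral.integral_sub (hI _ _) hc,
        intervalIntegral.integral_mul_const, ← e1]
      ring
    rw [e2]
    refine (intervalIntegral.norm_integral_le_of_norm_le_const (C := C * η) fun r hr => ?_).trans
      (by rw [hlen, abs_of_nonneg hd0])
    rw [uIoc_of_le hid] at hr
    have hr' : r ∈ Icc 0 t := ⟨hid0.trans hr.1.le, hr.2.trans hidt⟩
    rw [norm_mul]
    refine mul_le_mul (hC r hr') ?_ (norm_nonneg _) hC0
    rw [← dist_eq_norm]
    refine (hδw r hr' _ ⟨hid0.trans hid, hidt⟩ ?_).le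
    rw [Real.dist_eq, abs_sub_lt_iff]
    constructor <;> linarith [hr.1, hr.2]
  refine (norm_sum_le_of_le _ hterm).trans_lt ?_
  rw [Finset.sum_const, Finset.card_range, nsmul_eq_mul]
  have : (n : ℝ) * (C * η * d) = C * t * η := by rw [← hnd]; ring
  rw [this, hη, ← mul_div_assoc, div_lt_iff₀ hCt]
  nlinarith

variable {Ω : Type*} [MeasurableSpace Ω] {P : Measure Ω}

/-- A linear combination of independent centered Gaussian variables has the characteristic
function of a centered Gaussian variable. -/
theorem charFun_sum_gaussian {X : ℕ → Ω → ℝ} {v : ℕ → ℝ≥0} (hX : iIndepFun X P)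
    (hlaw : ∀ i, HasLaw (X i) (gaussianReal 0 (v i)) P) (c : ℕ → ℝ) (n : ℕ) (ξ : ℝ) :
    charFun (P.map fun w => ∑ i ∈ Finset.range n, c i * X i w) ξ
      = Complex.exp (-((∑ i ∈ Finset.range n, c i ^ 2 * v i : ℝ) : ℂ) * ξ ^ 2 / 2) := by
  have hlaw' : ∀ i, HasLaw (fun w => c i * X i w)
      (gaussianReal (c i * 0) (NNReal.mk (c i ^ 2) (sq_nonneg _) * v i)) P :=
    fun i => gaussianReal_const_mul (hlaw i) (c i)
  have hind : iIndepFun (fun i w => c i * X i w) P :=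
    hX.comp (fun i x => c i * x) fun i => by fun_prop
  rw [(hind.restrict (Finset.range n)).charFun_map_fun_finsetSum_eq_prod
    (fun i _ => (hlaw' i).aemeasurable), Finset.prod_apply]
  have : ∀ i ∈ Finset.range n, charFun (P.map fun w => c i * X i w) ξ
      = Complex.exp (-((c i ^ 2 * v i : ℝ) : ℂ) * ξ ^ 2 / 2) := by
    intro i _
    rw [(hlaw' i).map_eq, charFun_gaussianReal]
    congr 1
    push_cast
    simp
    ring
  rw [Finset.prod_congr rfl this, ← Complex.exp_sum]
  congr 1
  rw [← Finset.sum_div, ← Finset.sum_mul]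
  push_cast
  simp

/-- An almost sure limit of variables whose characteristic functions are centered Gaussian, with
converging variances, is centered Gaussian. -/
theorem hasLaw_gaussian_of_tendsto [IsProbabilityMeasure P] {Z : ℕ → Ω → ℝ} {Z' : Ω → ℝ} {V : ℕ → ℝ} {V' : ℝ}
    (hV' : 0 ≤ V') (hZ : ∀ n, AEMeasurable (Z n) P)
    (hchar : ∀ n ξ, charFun (P.map (Z n)) ξ = Complex.exp (-(V n : ℂ) * ξ ^ 2 / 2))
    (hV : Tendsto V atTop (𝓝 V')) (hlim : ∀ᵐ w ∂P, Tendsto (fun n => Z n w) atTop (𝓝 (Z' w))) :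
    HasLaw Z' (gaussianReal 0 V'.toNNReal) P := by
  have hZ' : AEMeasurable Z' P := aemeasurable_of_tendsto_metrizable_ae atTop hZ hlim
  refine ⟨hZ', ?_⟩
  have := Measure.isProbabilityMeasure_map (μ := P) hZ'
  refine Measure.ext_of_charFun (funext fun ξ => ?_)
  have hexp : Continuous fun x : ℝ => Complex.exp (ξ * x * Complex.I) := by fun_prop
  have key : ∀ {X : Ω → ℝ}, AEMeasurable X P →
      charFun (P.map X) ξ = ∫ w, Complex.exp (ξ * X w * Complex.I) ∂P := by
    intro X hX
    rw [charFun_apply_real, integral_map hX hexp.aestronglyMeasurable]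
  have h1 : Tendsto (fun n => charFun (P.map (Z n)) ξ) atTop (𝓝 (charFun (P.map Z') ξ)) := by
    rw [key hZ']
    simp_rw [fun n => key (hZ n)]
    refine tendsto_integral_of_dominated_convergence (fun _ => 1)
      (fun n => (hexp.measurable.comp_aemeasurable (hZ n)).aestronglyMeasurable)
      (integrable_const _) (fun n => ae_of_all _ fun w => ?_) ?_
    · have := Complex.norm_exp_ofReal_mul_I (ξ * Z n w)
      push_cast at this
      exact this.le
    · filter_upwards [hlim] with w hw
      exact (hexp.tendsto _).comp hw
  have h2 : Tendsto (fun n => charFun (P.map (Z n)) ξ) atTop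
      (𝓝 (charFun (gaussianReal 0 V'.toNNReal) ξ)) := by
    simp_rw [hchar, charFun_gaussianReal]
    have hc : Continuous fun x : ℝ => Complex.exp (-(x : ℂ) * ξ ^ 2 / 2) := by fun_prop
    convert! (hc.tendsto V').comp hV using 2
    rw [Real.coe_toNNReal V' hV']
    congr 1
    push_cast
    ring
  exact tendsto_nhds_unique h1 h2

/-- Evaluates, at rate `2 * κ`, the limit of the variances in `hasLaw_wiener_integral`. -/
theorem integral_exp_decay_mul_id {κ : ℝ} (hκ : 0 < κ) (t : ℝ) :
    ∫ r in (0 : ℝ)..t, κ * Real.exp (-κ * (t - r)) * r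
      = t - (1 - Real.exp (-κ * t)) / κ := by
  have hd : ∀ r ∈ uIcc 0 t, HasDerivAt (fun r => (r - 1 / κ) * Real.exp (-κ * (t - r)))
      (κ * Real.exp (-κ * (t - r)) * r) r := by
    intro r _
    convert! ((hasDerivAt_id r).sub_const (1 / κ)).mul (hasDerivAt_exp_decay κ t r) using 1
    simp only [id]
    field_simp
    ring
  rw [intervalIntegral.integral_eq_sub_of_hasDerivAt hd
    ((by fun_prop : Continuous fun r => κ * Real.exp (-κ * (t - r)) * r).intervalIntegrable _ _)]
  simp
  field_simp
  ring

/-- The Wiener integral `∫₀ᵗ exp (-κ (t - r)) dW r`, written by integration by parts, is centered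
Gaussian. -/
theorem hasLaw_wiener_integral [IsProbabilityMeasure P] {W : ℝ≥0 → Ω → ℝ} (hW : IsBrownianReal W P) {κ t : ℝ}
    (hκ : 0 < κ) (ht : 0 ≤ t) :
    HasLaw (fun w => W t.toNNReal w
        - κ * ∫ r in (0 : ℝ)..t, Real.exp (-κ * (t - r)) * W r.toNNReal w)
      (gaussianReal 0 ((1 - Real.exp (-2 * κ * t)) / (2 * κ)).toNNReal) P := by
  set τ : ℕ → ℕ → ℝ≥0 := fun n i => (i * (t / n) : ℝ).toNNReal with hτ
  have hτc : ∀ n i, (τ n i : ℝ) = i * (t / n) := fun n i => Real.coe_toNNReal _ (by positivity)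
  have hτm : ∀ n, Monotone (τ n) := fun n i j hij => Real.toNNReal_mono
    (mul_le_mul_of_nonneg_right (by exact_mod_cast hij) (by positivity))
  set f : ℝ → ℝ := fun r => Real.exp (-κ * (t - r)) with hf
  set X : ℕ → ℕ → Ω → ℝ := fun n i w => W (τ n (i + 1)) w - W (τ n i) w with hX
  have hXi : ∀ n, iIndepFun (X n) P := fun n => hW.hasIndepIncrements.nat (hτm n)
  have hXl : ∀ n i, HasLaw (X n i) (gaussianReal 0 (t / n).toNNReal) P := by
    intro n i
    convert! hW.hasLaw_sub (τ n (i + 1)) (τ n i) using 2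
    ext
    rw [Real.coe_toNNReal _ (by positivity), coe_nndist, Real.dist_eq, NNReal.val_eq_coe,
      NNReal.val_eq_coe, hτc, hτc]
    push_cast
    rw [show ((i : ℝ) + 1) * (t / n) - i * (t / n) = t / n by ring, abs_of_nonneg (by positivity)]
  have hv0 : 0 ≤ (1 - Real.exp (-2 * κ * t)) / (2 * κ) := by
    refine div_nonneg (sub_nonneg.2 (Real.exp_le_one_iff.2 ?_)) (by positivity)
    nlinarith [mul_nonneg hκ.le ht]
  refine hasLaw_gaussian_of_tendsto
    (Z := fun n w => ∑ i ∈ Finset.range n, f (i * (t / n)) * X n i w)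
    (V := fun n => ∑ i ∈ Finset.range n, f (i * (t / n)) ^ 2 * ((t / n).toNNReal : ℝ))
    hv0 (fun n => ?_) (fun n ξ => charFun_sum_gaussian (hXi n) (hXl n) _ n ξ) ?_ ?_
  · refine Finset.aemeasurable_fun_sum _ fun i _ => ?_
    exact (hXl n i).aemeasurable.const_mul _
  -- Squaring `f` doubles its rate, so the variances are sums of the same kind with the identity as
  -- integrator.
  · have h := tendsto_sum_mul_sub (w := fun r => r) (hasDerivAt_exp_decay (2 * κ) t)
      (by fun_prop) continuous_id ht
    rw [integral_exp_decay_mul_id (by positivity)] at h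
    convert! h using 2
    · refine Finset.sum_congr rfl fun i _ => ?_
      rw [Real.coe_toNNReal _ (by positivity), hf]
      push_cast
      rw [← Real.exp_nat_mul]
      congr 1
      · congr 1; push_cast; ring
      · ring
    · simp
  -- Pathwise convergence, with the Brownian path as integrator; `W 0 = 0` removes the boundary term
  -- at time zero.
  · filter_upwards [hW.cont, hW.eval_zero_ae_eq_zero] with w hw hw0
    have h := tendsto_sum_mul_sub (w := fun r => W r.toNNReal w) (hasDerivAt_exp_decay κ t)
      (by fun_prop) (hw.comp continuous_real_toNNReal) ht
    convert! h using 2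
    simp only [Real.toNNReal_zero, hw0, mul_assoc, intervalIntegral.integral_const_mul]
    simp

/-- The marginals of the Ornstein–Uhlenbeck process. -/
theorem IsOUProcess.hasLaw [IsProbabilityMeasure P] {W : ℝ≥0 → Ω → ℝ} (hW : IsBrownianReal W P)
    {κ σ y₀ T : ℝ} (hκ : 0 < κ) {μ : ℝ → ℝ} (hμ : IntegrableOn μ (Icc 0 T))
    {Y : ℝ → Ω → ℝ} (hY : IsOUProcess P W κ σ y₀ μ T Y) {t : ℝ} (ht : t ∈ Icc 0 T) :
    HasLaw (Y t) (gaussianReal (meanOUP κ y₀ μ t) (varOUP κ σ t).toNNReal) P := by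
  have hsub : Icc 0 t ⊆ Icc 0 T := Icc_subset_Icc_right ht.2
  have hlaw := gaussianReal_const_add
    (gaussianReal_const_mul (hasLaw_wiener_integral hW hκ ht.1) σ) (meanOUP κ y₀ μ t)
  have hY' : Y t =ᵐ[P] fun w => meanOUP κ y₀ μ t + σ * (W t.toNNReal w
      - κ * ∫ r in (0 : ℝ)..t, Real.exp (-κ * (t - r)) * W r.toNNReal w) := by
    filter_upwards [hW.cont, hY.continuousOn_path, hY.integral_eq] with w hw hc hi
    exact eq_meanOUP_add (w := fun r => W r.toNNReal w) (y := fun r => Y r w) ht.1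
      (hμ.mono_set hsub) (hc.mono hsub)
      (hw.comp continuous_real_toNNReal).continuousOn fun x hx => hi x (hsub hx)
  convert! hlaw.congr hY' using 2
  · simp
  · ext
    rw [NNReal.coe_mul, varOUP, Real.coe_toNNReal', Real.coe_toNNReal']
    simp only [NNReal.coe_mk]
    rw [mul_max_of_nonneg _ _ (sq_nonneg σ)]
    congr 1
    · field_simp
    · simp

end SupplyControl

/-! ### Existence: the characteristic formula is a weak solution. -/

namespace SupplyControl

/-- The source-compensated value `ρ · exp (-s x / lam)` carried by the characteristic through
`(x, t)`, as a function of `t - x / lam`: it comes from the initial state for negative arguments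
and from the inflow for nonnegative ones. -/
noncomputable def characteristicProfile (lam s b T : ℝ) (ρ₀ u : ℝ → ℝ) (τ : ℝ) : ℝ :=
  (Ioc 0 b).indicator (fun x => Real.exp (-(s * x / lam)) * ρ₀ x) (-lam * τ)
    + (Icc 0 T).indicator u τ

/-- The outflow trace of the advection equation obtained by following characteristics. -/
noncomputable def characteristicOutflow (lam s b T : ℝ) (ρ₀ u : ℝ → ℝ) (t : ℝ) : ℝ :=
  Real.exp (s * b / lam) * characteristicProfile lam s b T ρ₀ u (t - b / lam)

variable {lam s b T : ℝ} {ρ₀ u : ℝ → ℝ}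

theorem characteristicOutflow_of_lt (hlam : 0 < lam) {t : ℝ} (ht0 : 0 ≤ t) (ht : t < b / lam) :
    characteristicOutflow lam s b T ρ₀ u t = Real.exp (s * t) * ρ₀ (b - lam * t) := by
  have h1 : lam * t < b := by rw [lt_div_iff₀ hlam] at ht; linarith
  have h2 : -lam * (t - b / lam) = b - lam * t := by field_simp; ring
  have h3 : b - lam * t ∈ Ioc 0 b := ⟨by linarith, by nlinarith⟩
  have h4 : t - b / lam ∉ Icc 0 T := fun h => by linarith [h.1]
  rw [characteristicOutflow, characteristicProfile, h2, indicator_of_mem h3,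
    indicator_of_notMem h4, add_zero, ← mul_assoc, ← Real.exp_add]
  congr 2
  field_simp
  ring

theorem characteristicOutflow_of_le (hlam : 0 < lam) (hb : 0 < b) {t : ℝ} (ht : b / lam ≤ t)
    (htT : t ≤ T) :
    characteristicOutflow lam s b T ρ₀ u t = Real.exp (s * b / lam) * u (t - b / lam) := by
  have h1 : -lam * (t - b / lam) ∉ Ioc 0 b := fun h => by nlinarith [h.1]
  have h2 : t - b / lam ∈ Icc 0 T := ⟨by linarith, by linarith [div_pos hb hlam]⟩
  rw [characteristicOutflow, characteristicProfile, indicator_of_notMem h1, indicator_of_mem h2,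
    zero_add]

theorem integrable_initialProfile (hρ₀ : IntegrableOn ρ₀ (Icc 0 b)) :
    Integrable ((Ioc 0 b).indicator fun x => Real.exp (-(s * x / lam)) * ρ₀ x) := by
  rw [integrable_indicator_iff measurableSet_Ioc]
  refine IntegrableOn.mono_set ?_ Ioc_subset_Icc_self
  exact hρ₀.continuousOn_mul (by fun_prop) isCompact_Icc

theorem integrable_characteristicProfile (hlam : 0 < lam) (hρ₀ : IntegrableOn ρ₀ (Icc 0 b))
    (hu : IntegrableOn u (Icc 0 T)) : Integrable (characteristicProfile lam s b T ρ₀ u) :=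
  ((integrable_initialProfile hρ₀).comp_mul_left' (neg_ne_zero.2 hlam.ne')).add
    ((integrable_indicator_iff measurableSet_Icc).2 hu)

/-- Straightens the characteristics into lines of constant second coordinate without changing area,
so that Fubini can integrate along them. -/
theorem measurePreserving_shear (c : ℝ) :
    MeasurePreserving (fun p : ℝ × ℝ => (p.1, p.2 - p.1 / c)) volume volume :=
  MeasurePreserving.skew_product (g := fun x t => t - x / c) (MeasurePreserving.id volume)
    (by fun_prop) (Filter.Eventually.of_forall fun x => map_sub_right_eq_self volume (x / c))

/-- Along a characteristic the weighted adjoint operator is an exact derivative in `x`, so its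
integral reduces to values at the entry and exit points. -/
theorem hasDerivAt_along_characteristic (hlam : 0 < lam) {φ : ℝ × ℝ → ℝ}
    (hφ : Differentiable ℝ φ) (τ x : ℝ) :
    HasDerivAt (fun x => lam * (Real.exp (s * x / lam) * φ (x, τ + x / lam)))
      (Real.exp (s * x / lam) * (fderiv ℝ φ (x, τ + x / lam) (0, 1)
        + lam * fderiv ℝ φ (x, τ + x / lam) (1, 0) + s * φ (x, τ + x / lam))) x := by
  have h1 : HasDerivAt (fun x : ℝ => Real.exp (s * x / lam))
      (Real.exp (s * x / lam) * (s / lam)) x := by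
    have : HasDerivAt (fun x : ℝ => s * x / lam) (s / lam) x := by
      simpa using ((hasDerivAt_id x).const_mul s).div_const lam
    exact this.exp
  have h2 : HasDerivAt (fun x : ℝ => (x, τ + x / lam)) ((1 : ℝ), 1 / lam) x :=
    (hasDerivAt_id x).prodMk (((hasDerivAt_id x).div_const lam).const_add τ)
  have h3 := (hφ (x, τ + x / lam)).hasFDerivAt.comp_hasDerivAt x h2
  have h4 : ((1 : ℝ), 1 / lam) = ((1 : ℝ), (0 : ℝ)) + (1 / lam) • ((0 : ℝ), (1 : ℝ)) := by simp
  rw [h4, map_add, map_smul, smul_eq_mul] at h3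
  convert! (h1.mul h3).const_mul lam using 1
  simp only [Function.comp]
  field_simp
  ring

/-- Integrating the density term along each characteristic leaves two values: the exit at `x = b`
gives the outflow term, and the entry gives the initial term (`τ < 0`) or the inflow term (`τ ≥ 0`).
-/
theorem isWeakSolution_characteristic (hlam : 0 < lam) (hb : 0 < b)
    (hρ₀ : IntegrableOn ρ₀ (Icc 0 b)) (hu : IntegrableOn u (Icc 0 T)) :
    IsWeakSolution lam s b T ρ₀ u
      (fun p => Real.exp (s * p.1 / lam) * characteristicProfile lam s b T ρ₀ u (p.2 - p.1 / lam))
      (characteristicOutflow lam s b T ρ₀ u) := by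
  set G := characteristicProfile lam s b T ρ₀ u with hG
  have hGi : Integrable G := integrable_characteristicProfile hlam hρ₀ hu
  have hexpi : Integrable ((Icc 0 b).indicator fun x => Real.exp (s * x / lam)) := by
    rw [integrable_indicator_iff measurableSet_Icc]
    exact (by fun_prop : Continuous fun x => Real.exp (s * x / lam)).continuousOn.integrableOn_Icc
  have hprod : Integrable (fun p : ℝ × ℝ =>
      (Icc 0 b).indicator (fun x => Real.exp (s * x / lam)) p.1 * G p.2) := hexpi.mul_prod hGi
  have hsheared := (measurePreserving_shear lam).integrable_comp_of_integrable hprod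
  refine ⟨?_, ?_, fun φ hφ hφc hφT => ?_⟩
  · refine (hsheared.integrableOn (s := Icc (0 : ℝ) b ×ˢ Icc (0 : ℝ) T)).congr_fun (fun p hp => ?_)
      (measurableSet_Icc.prod measurableSet_Icc)
    simp only [Function.comp]
    rw [indicator_of_mem hp.1]
  · exact ((hGi.comp_sub_right (b / lam)).const_mul _).integrableOn
  · have hdiff : Differentiable ℝ φ := hφ.differentiable (by simp)
    set D : ℝ × ℝ → ℝ := fun p => fderiv ℝ φ p (0, 1) + lam * fderiv ℝ φ p (1, 0) + s * φ p with hD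
    have hfc : Continuous (fderiv ℝ φ) := hφ.continuous_fderiv (by simp)
    have hφcont : Continuous φ := hφ.continuous
    have hDc : Continuous D := by fun_prop
    have hφ0 : ∀ p : ℝ × ℝ, T ≤ p.2 → φ p = 0 := fun p hp => by
      by_contra h
      exact absurd (hφT (subset_tsupport _ h)) (not_lt.2 hp)
    have hD0 : ∀ p : ℝ × ℝ, T ≤ p.2 → D p = 0 := fun p hp => by
      have h1 : fderiv ℝ φ p = 0 := by
        by_contra h
        exact absurd (hφT (support_fderiv_subset ℝ h)) (not_lt.2 hp)
      simp [hD, h1, hφ0 p hp]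
    obtain ⟨C, hC⟩ : ∃ C, ∀ p, ‖D p‖ ≤ C := by
      refine hDc.bounded_above_of_compact_support (hφc.mono' ?_)
      intro p hp
      by_contra h
      have h1 : fderiv ℝ φ p = 0 := by
        by_contra h'
        exact h (support_fderiv_subset ℝ h')
      exact hp (by simp [hD, h1, image_eq_zero_of_notMem_tsupport h])
    obtain ⟨Cφ, hCφ⟩ := hφcont.bounded_above_of_compact_support hφc
    -- the density term, in the coordinates `(x, t - x / lam)`
    set K : ℝ × ℝ → ℝ := (Icc (0 : ℝ) b ×ˢ Icc (0 : ℝ) T).indicator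
      (fun p => Real.exp (s * p.1 / lam) * G (p.2 - p.1 / lam) * D p) with hK
    have hKi : Integrable K := by
      have h1 : Integrable (fun p : ℝ × ℝ => D p *
          ((fun p : ℝ × ℝ => (Icc 0 b).indicator (fun x => Real.exp (s * x / lam)) p.1 * G p.2) ∘
            fun p : ℝ × ℝ => (p.1, p.2 - p.1 / lam)) p) :=
        hsheared.bdd_mul hDc.aestronglyMeasurable (ae_of_all _ hC)
      refine (h1.indicator (measurableSet_Icc.prod measurableSet_Icc)
        (s := Icc (0 : ℝ) b ×ˢ Icc (0 : ℝ) T)).congr (ae_of_all _ fun p => ?_)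
      by_cases hp : p ∈ Icc (0 : ℝ) b ×ˢ Icc (0 : ℝ) T
      · simp only [hK, indicator_of_mem hp, Function.comp]
        rw [indicator_of_mem hp.1]
        ring
      · simp only [hK, indicator_of_notMem hp]
    have hKs : Integrable (fun p : ℝ × ℝ => K (p.1, p.2 + p.1 / lam)) := by
      have := (measurePreserving_shear (-lam)).integrable_comp_of_integrable hKi
      simpa [Function.comp_def, div_neg, sub_neg_eq_add] using this
    have hfub : ∫ p, K p = ∫ τ, ∫ x, K (x, τ + x / lam) := by
      rw [Measure.volume_eq_prod, integral_prod _ hKi]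
      rw [← integral_integral_swap (f := fun x τ => K (x, τ + x / lam)) hKs]
      congr 1
      ext x
      exact (integral_add_right_eq_self (fun t => K (x, t)) (x / lam)).symm
    set h : ℝ → ℝ → ℝ := fun τ x => Real.exp (s * x / lam) * φ (x, τ + x / lam) with hh
    -- The characteristic enters the rectangle at `x = max 0 (-lam * τ)`. If this exceeds `b`, then
    -- `G τ = 0`. The cut at `t = T` costs nothing because `D` vanishes from there on.
    have hinner : ∀ τ, ∫ x, K (x, τ + x / lam)
        = lam * (G τ * h τ b) - lam * (G τ * h τ (max 0 (-lam * τ))) := by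
      intro τ
      have e1 : (fun x => K (x, τ + x / lam)) = fun x => G τ * (Icc (max 0 (-lam * τ)) b).indicator
          (fun x => Real.exp (s * x / lam) * D (x, τ + x / lam)) x := by
        ext x
        have hiff : 0 ≤ τ + x / lam ↔ -lam * τ ≤ x := by
          rw [← mul_nonneg_iff_of_pos_left hlam, mul_add, mul_div_cancel₀ _ hlam.ne']
          constructor <;> intro h <;> linarith
        by_cases hx : x ∈ Icc (max 0 (-lam * τ)) b
        · rw [indicator_of_mem hx]
          have hx0 := max_le_iff.1 hx.1
          by_cases hxT : τ + x / lam ≤ T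
          · have : (x, τ + x / lam) ∈ Icc (0 : ℝ) b ×ˢ Icc (0 : ℝ) T :=
              ⟨⟨hx0.1, hx.2⟩, hiff.2 hx0.2, hxT⟩
            rw [hK, indicator_of_mem this]
            simp only [add_sub_cancel_right]
            ring
          · have : (x, τ + x / lam) ∉ Icc (0 : ℝ) b ×ˢ Icc (0 : ℝ) T := fun h => hxT h.2.2
            rw [hK, indicator_of_notMem this, hD0 _ (not_le.1 hxT).le]
            simp
        · rw [indicator_of_notMem hx, mul_zero, hK, indicator_of_notMem]
          exact fun h => hx ⟨max_le h.1.1 (hiff.1 h.2.1), h.1.2⟩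
      rw [e1, integral_const_mul, integral_indicator measurableSet_Icc]
      rcases le_or_gt (max 0 (-lam * τ)) b with hle | hgt
      · rw [integral_Icc_eq_integral_Ioc, ← intervalIntegral.integral_of_le hle,
          intervalIntegral.integral_eq_sub_of_hasDerivAt
            (fun x _ => hasDerivAt_along_characteristic hlam hdiff τ x)]
        · simp only [hh]; ring
        · exact (by fun_prop : Continuous fun x =>
            Real.exp (s * x / lam) * D (x, τ + x / lam)).intervalIntegrable _ _
      · have hlt : b < -lam * τ := by
          rcases lt_max_iff.1 hgt with h | h
          · linarith
          · exact h
        have hG0 : G τ = 0 := by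
          rw [hG, characteristicProfile, indicator_of_notMem, indicator_of_notMem, add_zero]
          · exact fun h => by nlinarith [h.1]
          · exact fun h => by linarith [h.2]
        simp [hG0]
    set r : ℝ → ℝ := (Ioc 0 b).indicator fun x => Real.exp (-(s * x / lam)) * ρ₀ x with hr
    set U : ℝ → ℝ := (Icc 0 T).indicator u with hU
    have hUi : Integrable U := (integrable_indicator_iff measurableSet_Icc).2 hu
    set R : ℝ → ℝ := (Ioc 0 b).indicator fun x => ρ₀ x * φ (x, 0) with hR
    have hRi : Integrable R := by
      rw [hR, integrable_indicator_iff measurableSet_Ioc]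
      refine IntegrableOn.mono_set ?_ Ioc_subset_Icc_self
      exact hρ₀.mul_continuousOn (by fun_prop) isCompact_Icc
    have hUφ : Integrable fun τ => U τ * φ (0, τ) :=
      hUi.mul_bdd (by fun_prop) (ae_of_all _ fun τ => hCφ (0, τ))
    have hend : ∀ τ, G τ * h τ (max 0 (-lam * τ)) = R (-lam * τ) + U τ * φ (0, τ) := by
      intro τ
      have hGτ : G τ = r (-lam * τ) + U τ := rfl
      rcases lt_or_ge τ 0 with hτ | hτ
      · have hU0 : U τ = 0 := indicator_of_notMem (fun h => by linarith [h.1]) _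
        have hτ' : 0 < -lam * τ := by nlinarith
        rw [hGτ, hU0, max_eq_right hτ'.le, hh]
        have : τ + -lam * τ / lam = 0 := by field_simp; ring
        simp only [this, zero_mul, add_zero]
        by_cases hmem : -lam * τ ∈ Ioc 0 b
        · rw [hr, hR, indicator_of_mem hmem, indicator_of_mem hmem]
          rw [show Real.exp (-(s * (-lam * τ) / lam)) * ρ₀ (-lam * τ)
              * (Real.exp (s * (-lam * τ) / lam) * φ (-lam * τ, 0))
            = (Real.exp (-(s * (-lam * τ) / lam)) * Real.exp (s * (-lam * τ) / lam))
              * (ρ₀ (-lam * τ) * φ (-lam * τ, 0)) by ring, ← Real.exp_add]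
          simp
        · rw [hr, hR, indicator_of_notMem hmem, indicator_of_notMem hmem, zero_mul]
      · have hτ' : -lam * τ ≤ 0 := by nlinarith
        have hmem : -lam * τ ∉ Ioc 0 b := fun h => by linarith [h.1]
        rw [hGτ, max_eq_left hτ', hr, hR, indicator_of_notMem hmem, indicator_of_notMem hmem, hh]
        simp
    have hGb : Integrable fun τ => G τ * h τ b := by
      refine hGi.mul_bdd (c := Real.exp (s * b / lam) * Cφ) (by fun_prop) (ae_of_all _ fun τ => ?_)
      rw [hh, norm_mul, Real.norm_of_nonneg (Real.exp_pos _).le]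
      exact mul_le_mul_of_nonneg_left (hCφ _) (Real.exp_pos _).le
    have hRs : Integrable fun τ => R (-lam * τ) := hRi.comp_mul_left' (by linarith)
    -- After the shift by `b / lam` the integrand vanishes off `[0, T]`: before `0` because of `G`,
    -- after `T` because of `φ`.
    have hout : ∫ τ, G τ * h τ b
        = ∫ t in Icc 0 T, characteristicOutflow lam s b T ρ₀ u t * φ (b, t) := by
      rw [← integral_sub_right_eq_self (fun τ => G τ * h τ b) (b / lam),
        ← integral_indicator measurableSet_Icc]
      congr 1
      ext t
      simp only [hh, sub_add_cancel]
      by_cases ht : t ∈ Icc 0 T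
      · rw [indicator_of_mem ht, characteristicOutflow]
        ring
      · rw [indicator_of_notMem ht]
        rcases lt_or_ge t 0 with h0 | h0
        · have hG0 : G (t - b / lam) = 0 := by
            have hbl : 0 < b / lam := div_pos hb hlam
            rw [hG, characteristicProfile, indicator_of_notMem, indicator_of_notMem, add_zero]
            · exact fun h => by linarith [h.1]
            · intro h
              have h1 : -lam * (t - b / lam) = b - lam * t := by field_simp; ring
              rw [h1] at h
              nlinarith [h.2]
          rw [hG0, zero_mul]
        · rw [hφ0 (b, t) (not_le.1 fun h => ht ⟨h0, h⟩).le, mul_zero, mul_zero]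
    have hinit : ∫ τ, R (-lam * τ) = lam⁻¹ * ∫ x in Icc 0 b, ρ₀ x * φ (x, 0) := by
      rw [Measure.integral_comp_mul_left, hR, integral_indicator measurableSet_Ioc,
        integral_Icc_eq_integral_Ioc, smul_eq_mul, abs_inv, abs_neg, abs_of_pos hlam]
    have hin : ∫ τ, U τ * φ (0, τ) = ∫ t in Icc 0 T, u t * φ (0, t) := by
      rw [← integral_indicator measurableSet_Icc]
      congr 1
      ext t
      by_cases ht : t ∈ Icc 0 T
      · rw [hU, indicator_of_mem ht, indicator_of_mem ht]
      · rw [hU, indicator_of_notMem ht, indicator_of_notMem ht, zero_mul]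
    have htotal : ∫ p in Icc (0 : ℝ) b ×ˢ Icc (0 : ℝ) T,
        Real.exp (s * p.1 / lam) * G (p.2 - p.1 / lam) * D p
        = lam * (∫ t in Icc 0 T, characteristicOutflow lam s b T ρ₀ u t * φ (b, t))
          - lam * (lam⁻¹ * (∫ x in Icc 0 b, ρ₀ x * φ (x, 0)) + ∫ t in Icc 0 T, u t * φ (0, t)) := by
      rw [← integral_indicator (measurableSet_Icc.prod measurableSet_Icc), ← hK, hfub]
      have hRU : Integrable fun τ => R (-lam * τ) + U τ * φ (0, τ) := hRs.add hUφ
      simp_rw [hinner, hend]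
      rw [integral_sub (hGb.const_mul lam) (hRU.const_mul lam), integral_const_mul,
        integral_const_mul, integral_add hRs hUφ, hout, hinit, hin]
    rw [htotal, mul_add, mul_inv_cancel_left₀ hlam.ne']
    ring

/-- The weak form sees the trace only under an integral. This is the freedom used to meet the chance
constraint at every single time. -/
theorem IsWeakSolution.congr_outflow {ρ : ℝ × ℝ → ℝ} {S S' : ℝ → ℝ}
    (h : IsWeakSolution lam s b T ρ₀ u ρ S) (hS : S =ᵐ[volume.restrict (Icc 0 T)] S') :
    IsWeakSolution lam s b T ρ₀ u ρ S' where
  integrableOn_density := h.integrableOn_density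
  integrableOn_outflow := h.integrableOn_outflow.congr hS
  weak_form φ hφ hφc hφT := by
    have hint : ∫ t in Icc 0 T, S' t * φ (b, t) = ∫ t in Icc 0 T, S t * φ (b, t) := by
      refine integral_congr_ae ?_
      filter_upwards [hS] with t ht
      rw [ht]
    rw [hint]
    exact h.weak_form φ hφ hφc hφT

theorem isSupply_of_ae_eq (hlam : 0 < lam) (hb : 0 < b) (hρ₀ : IntegrableOn ρ₀ (Icc 0 b))
    (hu : IntegrableOn u (Icc 0 T)) {S : ℝ → ℝ}
    (hS : characteristicOutflow lam s b T ρ₀ u =ᵐ[volume.restrict (Icc 0 T)] S) :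
    IsSupply lam s b T ρ₀ u S :=
  ⟨_, (isWeakSolution_characteristic hlam hb hρ₀ hu).congr_outflow hS⟩

end SupplyControl

/-! ### Uniqueness of the outflow trace by duality. -/

namespace SupplyControl

/-- The test function that transports the profile `g` along characteristics, cut off in space
by `χ`. -/
noncomputable def transportedTest (lam s : ℝ) (χ g : ℝ → ℝ) (p : ℝ × ℝ) : ℝ :=
  χ p.1 * (Real.exp (-(s * p.1 / lam)) * g (p.2 - p.1 / lam))

variable {lam s b T : ℝ} {ρ₀ u S : ℝ → ℝ} {ρ : ℝ × ℝ → ℝ}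

/-- In the direction `(lam, 1)` the argument of `g` is constant and the exponential decays at rate
`s`, which cancels the source; where `χ` is locally `1` the cutoff adds no derivative. -/
theorem transportedTest_adjoint_eq_zero (hlam : 0 < lam) {χ g : ℝ → ℝ}
    (hφ : Differentiable ℝ (transportedTest lam s χ g)) {p : ℝ × ℝ}
    (hχ : ∀ᶠ x in nhds p.1, χ x = 1) :
    fderiv ℝ (transportedTest lam s χ g) p (0, 1)
      + lam * fderiv ℝ (transportedTest lam s χ g) p (1, 0)
      + s * transportedTest lam s χ g p = 0 := by
  set φ := transportedTest lam s χ g with hφdef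
  set c := g (p.2 - p.1 / lam) with hc
  have hline : HasDerivAt (fun r : ℝ => (p.1 + lam * r, p.2 + r)) ((lam : ℝ), (1 : ℝ)) 0 := by
    refine HasDerivAt.prodMk ?_ ?_
    · simpa using ((hasDerivAt_id (0 : ℝ)).const_mul lam).const_add p.1
    · simpa using (hasDerivAt_id (0 : ℝ)).const_add p.2
  have h0 : (p.1 + lam * 0, p.2 + 0) = p := by simp
  have h1 : HasDerivAt (fun r : ℝ => φ (p.1 + lam * r, p.2 + r)) (fderiv ℝ φ p (lam, 1)) 0 :=
    HasFDerivAt.comp_hasDerivAt_of_eq (0 : ℝ) (hφ p).hasFDerivAt hline h0.symm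
  have h2 : HasDerivAt (fun r : ℝ => Real.exp (-(s * (p.1 + lam * r) / lam)) * c)
      (-(s * φ p)) 0 := by
    have hin : HasDerivAt (fun r : ℝ => -(s * (p.1 + lam * r) / lam)) (-s) 0 := by
      have := (((((hasDerivAt_id (0 : ℝ)).const_mul lam).const_add p.1).const_mul s).div_const
        lam).neg
      convert! this using 1
      field_simp
    convert! hin.exp.mul_const c using 1
    rw [hφdef, transportedTest, hχ.self_of_nhds, mul_zero, add_zero, hc]
    ring
  have h3 : (fun r : ℝ => φ (p.1 + lam * r, p.2 + r))
      =ᶠ[nhds 0] fun r => Real.exp (-(s * (p.1 + lam * r) / lam)) * c := by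
    have hcont : Filter.Tendsto (fun r : ℝ => p.1 + lam * r) (nhds 0) (nhds p.1) := by
      have : Continuous fun r : ℝ => p.1 + lam * r := by fun_prop
      simpa using this.tendsto 0
    filter_upwards [hcont.eventually hχ] with r hr
    rw [hφdef, transportedTest, hr, one_mul, hc]
    congr 2
    field_simp
    ring
  have h4 := h1.unique (h2.congr_of_eventuallyEq h3)
  have h5 : ((lam : ℝ), (1 : ℝ)) = ((0 : ℝ), (1 : ℝ)) + lam • ((1 : ℝ), (0 : ℝ)) := by simp
  rw [h5, map_add, map_smul, smul_eq_mul] at h4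
  linarith

/-- The outflow trace of a weak solution is the inflow delayed by `b / lam` and amplified by
`exp (s b / lam)`. -/
theorem IsWeakSolution.outflow_ae_eq (hlam : 0 < lam) (hb : 0 < b)
    (h : IsWeakSolution lam s b T ρ₀ u ρ S) (hu : IntegrableOn u (Icc 0 T)) :
    ∀ᵐ τ : ℝ, τ ∈ Ioo 0 (T - b / lam) →
      Real.exp (-(s * b / lam)) * S (τ + b / lam) - u τ = 0 := by
  have hbl : 0 < b / lam := div_pos hb hlam
  rcases le_or_gt (T - b / lam) 0 with hT | hT
  · exact ae_of_all _ fun τ hτ => absurd (hτ.1.trans hτ.2) (not_lt.2 hT)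
  have hSshift : IntegrableOn (fun τ => S (τ + b / lam)) (Icc 0 (T - b / lam)) := by
    have h1 : Integrable ((Icc 0 T).indicator S) :=
      (integrable_indicator_iff measurableSet_Icc).2 h.integrableOn_outflow
    refine (h1.comp_add_right (b / lam)).integrableOn.congr_fun (fun τ hτ => ?_) measurableSet_Icc
    have hmem : τ + b / lam ∈ Icc 0 T := ⟨by linarith [hτ.1], by linarith [hτ.2]⟩
    exact indicator_of_mem hmem S
  have hu' : IntegrableOn u (Icc 0 (T - b / lam)) :=
    hu.mono_set (Icc_subset_Icc_right (by linarith))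
  have hloc : IntegrableOn (fun τ => Real.exp (-(s * b / lam)) * S (τ + b / lam) - u τ)
      (Icc 0 (T - b / lam)) := (hSshift.const_mul _).sub hu'
  -- Fundamental lemma of the calculus of variations: it suffices to test against smooth `g` with
  -- compact support in the open interval.
  refine isOpen_Ioo.ae_eq_zero_of_integral_contDiff_smul_eq_zero
    (hloc.mono_set Ioo_subset_Icc_self).locallyIntegrableOn fun g hg hgc hgs => ?_
  have hgK : IsCompact (tsupport g) := hgc
  -- Inserting the midpoint guarantees a greatest element even when `g` has empty support.
  obtain ⟨M, hM⟩ := (hgK.insert ((T - b / lam) / 2)).exists_isGreatest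
    (insert_nonempty _ _)
  have hMT : M < T - b / lam := by
    rcases hM.1 with rfl | hM
    · linarith
    · exact (hgs hM).2
  -- The cutoff reaches `x = b + 2 * δ`, where transport takes `b / lam` plus two thirds of the
  -- spare time, so the support stays in `t < T`.
  set δ := lam * (T - b / lam - M) / 3 with hδ
  have hδ0 : 0 < δ := by
    have : 0 < T - b / lam - M := by linarith
    positivity
  set χ : ContDiffBump (b / 2) := ⟨b / 2 + δ, b / 2 + 2 * δ, by positivity, by linarith⟩ with hχ
  set φ := transportedTest lam s χ g with hφ
  have hφsmooth : ContDiff ℝ (⊤ : ℕ∞) φ := by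
    have h1 : ContDiff ℝ (⊤ : ℕ∞) χ := χ.contDiff
    exact (h1.comp contDiff_fst).mul ((by fun_prop : ContDiff ℝ (⊤ : ℕ∞) fun p : ℝ × ℝ =>
      Real.exp (-(s * p.1 / lam))).mul (hg.comp (by fun_prop)))
  set Z : Set (ℝ × ℝ) := (fun q : ℝ × ℝ => (q.1, q.2 + q.1 / lam)) ''
    (Metric.closedBall (b / 2) χ.rOut ×ˢ tsupport g) with hZ
  have hZc : IsCompact Z :=
    ((isCompact_closedBall _ _).prod hgK).image (by fun_prop)
  have hφZ : ∀ p, p ∉ Z → φ p = 0 := by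
    intro p hp
    by_contra hne
    rw [hφ, transportedTest] at hne
    refine hp ⟨(p.1, p.2 - p.1 / lam), ⟨?_, ?_⟩, by simp⟩
    · rw [← χ.tsupport_eq]
      exact subset_tsupport _ (left_ne_zero_of_mul hne)
    · exact subset_tsupport _ (right_ne_zero_of_mul (right_ne_zero_of_mul hne))
  have hφT : tsupport φ ⊆ {p : ℝ × ℝ | p.2 < T} := by
    refine (closure_minimal (s := Function.support φ) (fun p hp => by_contra fun h => hp (hφZ p h)) hZc.isClosed).trans ?_
    rintro _ ⟨⟨x, τ⟩, ⟨hx, hτ⟩, rfl⟩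
    have hx' : x ≤ b + 2 * δ := by
      have := (abs_le.1 (Metric.mem_closedBall.1 hx : dist x (b / 2) ≤ b / 2 + 2 * δ)).2
      linarith
    have hτM : τ ≤ M := hM.2 (mem_insert_of_mem _ hτ)
    have hxl : x / lam ≤ b / lam + 2 * (T - b / lam - M) / 3 := by
      rw [div_le_iff₀ hlam]
      refine hx'.trans (le_of_eq ?_)
      rw [hδ]
      field_simp
    change τ + x / lam < T
    linarith
  have hχ1 : ∀ x ∈ Icc 0 b, ∀ᶠ y in nhds x, χ y = 1 := by
    intro x hx
    have hball : x ∈ Metric.ball (b / 2) χ.rIn := by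
      change |x - b / 2| < b / 2 + δ
      rw [abs_lt]
      constructor <;> linarith [hx.1, hx.2]
    filter_upwards [Metric.isOpen_ball.mem_nhds hball] with y hy
    exact χ.one_of_mem_closedBall (Metric.ball_subset_closedBall hy)
  have hg0 : ∀ τ, τ ∉ Ioo 0 (T - b / lam) → g τ = 0 :=
    fun τ hτ => image_eq_zero_of_notMem_tsupport fun h => hτ (hgs h)
  have hweak := h.weak_form φ hφsmooth (HasCompactSupport.intro hZc hφZ) hφT
  have hdens : ∫ p in Icc (0 : ℝ) b ×ˢ Icc (0 : ℝ) T,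
      ρ p * (fderiv ℝ φ p (0, 1) + lam * fderiv ℝ φ p (1, 0) + s * φ p) = 0 := by
    refine setIntegral_eq_zero_of_forall_eq_zero fun p hp => ?_
    rw [transportedTest_adjoint_eq_zero hlam (hφsmooth.differentiable (by simp)) (hχ1 _ hp.1),
      mul_zero]
  have hinit : ∫ x in Icc 0 b, ρ₀ x * φ (x, 0) = 0 := by
    refine setIntegral_eq_zero_of_forall_eq_zero fun x hx => ?_
    have : g (0 - x / lam) = 0 := hg0 _ fun h => by
      linarith [h.1, div_nonneg hx.1 hlam.le]
    simp only [hφ, transportedTest, this, mul_zero]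
  have hin : ∫ t in Icc 0 T, u t * φ (0, t) = ∫ τ, u τ * g τ := by
    rw [← setIntegral_eq_integral_of_forall_compl_eq_zero (s := Icc 0 T)
      (f := fun τ => u τ * g τ)]
    · have h1 : χ 0 = 1 := (hχ1 0 ⟨le_rfl, hb.le⟩).self_of_nhds
      simp [hφ, transportedTest, h1]
    · intro τ hτ
      rw [hg0 τ fun h => hτ ⟨h.1.le, by linarith [h.2]⟩, mul_zero]
  have hout : ∫ t in Icc 0 T, S t * φ (b, t)
      = ∫ τ, Real.exp (-(s * b / lam)) * S (τ + b / lam) * g τ := by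
    have h1 : χ b = 1 := (hχ1 b ⟨hb.le, le_rfl⟩).self_of_nhds
    have h2 : ∀ t, S t * φ (b, t)
        = Real.exp (-(s * b / lam)) * S (t - b / lam + b / lam) * g (t - b / lam) := by
      intro t
      simp only [hφ, transportedTest, h1, sub_add_cancel]
      ring
    rw [← integral_sub_right_eq_self
      (fun τ => Real.exp (-(s * b / lam)) * S (τ + b / lam) * g τ) (b / lam),
      setIntegral_eq_integral_of_forall_compl_eq_zero]
    · exact integral_congr_ae (ae_of_all _ h2)
    · intro t ht
      rw [h2, hg0 _ fun h => ht ⟨by linarith [h.1], by linarith [h.2]⟩, mul_zero]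
  have hint : ∀ {f : ℝ → ℝ}, IntegrableOn f (Icc 0 (T - b / lam)) →
      Integrable fun τ => f τ * g τ := by
    intro f hf
    rw [← integrableOn_iff_integrable_of_support_subset (s := Icc 0 (T - b / lam))]
    · exact hf.mul_continuousOn hg.continuous.continuousOn isCompact_Icc
    · intro τ hτ
      by_contra h
      exact hτ (by simp [hg0 τ fun h' => h (Ioo_subset_Icc_self h')])
  rw [hdens, hinit, hin, hout] at hweak
  have hzero : ∫ τ, g τ • (Real.exp (-(s * b / lam)) * S (τ + b / lam) - u τ)
      = (∫ τ, Real.exp (-(s * b / lam)) * S (τ + b / lam) * g τ) - ∫ τ, u τ * g τ := by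
    rw [← integral_sub (hint (hSshift.const_mul _)) (hint hu')]
    congr 1
    ext τ
    rw [smul_eq_mul]
    ring
  rw [hzero]
  have hmul : lam * ((∫ τ, Real.exp (-(s * b / lam)) * S (τ + b / lam) * g τ)
      - ∫ τ, u τ * g τ) = 0 := by linarith
  exact (mul_eq_zero.1 hmul).resolve_left hlam.ne'

end SupplyControl

/-! ### Reduction to a pointwise problem, and feasibility. -/

namespace SupplyControl

theorem continuousOn_meanOUP {κ y₀ T : ℝ} {μ : ℝ → ℝ} (hμ : IntegrableOn μ (Icc 0 T)) :
    ContinuousOn (meanOUP κ y₀ μ) (Icc 0 T) := by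
  rcases lt_or_ge T 0 with hT | hT
  · simp [Icc_eq_empty (not_le.2 hT)]
  have hi : IntegrableOn (fun r => Real.exp (κ * r) * μ r) (uIcc 0 T) := by
    rw [uIcc_of_le hT]
    exact hμ.continuousOn_mul (by fun_prop) isCompact_Icc
  have hprim := intervalIntegral.continuousOn_primitive_interval hi
  rw [uIcc_of_le hT] at hprim
  -- Pulling out `exp (-κ * t)` leaves a primitive of a fixed integrable function.
  have heq : meanOUP κ y₀ μ = fun t => y₀ * Real.exp (-κ * t)
      + κ * (Real.exp (-κ * t) * ∫ r in (0 : ℝ)..t, Real.exp (κ * r) * μ r) := by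
    ext t
    rw [meanOUP, ← intervalIntegral.integral_const_mul (Real.exp (-κ * t))]
    congr 3
    ext r
    rw [← mul_assoc, ← Real.exp_add]
    congr 2
    ring
  rw [heq]
  exact (by fun_prop : Continuous fun t => y₀ * Real.exp (-κ * t)).continuousOn.add
    (((by fun_prop : Continuous fun t => Real.exp (-κ * t)).continuousOn.mul hprim).const_mul κ)

theorem continuous_varOUP (κ σ : ℝ) : Continuous (varOUP κ σ) := by
  unfold varOUP
  fun_prop

theorem varOUP_pos {κ σ t : ℝ} (hκ : 0 < κ) (hσ : 0 < σ) (ht : 0 < t) : 0 < varOUP κ σ t := by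
  have : Real.exp (-2 * κ * t) < 1 := Real.exp_lt_one_iff.2 (by nlinarith [mul_pos hκ ht])
  unfold varOUP
  have := sub_pos.2 this
  positivity

theorem continuousOn_quantileBound {κ σ y₀ T : ℝ} {μ : ℝ → ℝ} (hμ : IntegrableOn μ (Icc 0 T))
    (θ : ℝ) : ContinuousOn (quantileBound κ σ y₀ μ θ) (Icc 0 T) :=
  (continuousOn_meanOUP hμ).add
    (((continuous_varOUP κ σ).sqrt.mul continuous_const).continuousOn)

variable {Ω : Type*} [MeasurableSpace Ω] {P : Measure Ω}

/-- Supplies a trace value at the exceptional times where the initial outflow violates the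
constraint. Continuity from below needs no measurability of `X`. -/
theorem exists_ofReal_le_measure_le [IsProbabilityMeasure P] (X : Ω → ℝ) {p : ℝ} (hp : p < 1) :
    ∃ c : ℝ, ENNReal.ofReal p ≤ P {w | X w ≤ c} := by
  by_contra! hcon
  have hmono : Monotone fun n : ℕ => {w | X w ≤ n} :=
    fun m n hmn w (hw : X w ≤ m) => hw.trans (Nat.cast_le.2 hmn)
  have hU : ⋃ n : ℕ, {w | X w ≤ n} = univ :=
    eq_univ_of_forall fun w => mem_iUnion.2 (exists_nat_ge (X w))
  have h := hmono.measure_iUnion (μ := P)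
  rw [hU, measure_univ] at h
  have hle : (1 : ℝ≥0∞) ≤ ENNReal.ofReal p := h.le.trans (iSup_le fun n => (hcon n).le)
  rw [ENNReal.one_le_ofReal] at hle
  exact absurd hp (not_lt.2 hle)

section OUP

variable [IsProbabilityMeasure P] {W : ℝ≥0 → Ω → ℝ} {κ σ y₀ T θ t₁ : ℝ} {μ : ℝ → ℝ}
  {Y : ℝ → Ω → ℝ} {S : ℝ → ℝ}

theorem trackingCost_eq (hW : IsBrownianReal W P) (hκ : 0 < κ) (hσ : 0 < σ)
    (hμ : IntegrableOn μ (Icc 0 T)) (hY : IsOUProcess P W κ σ y₀ μ T Y) (ht₁ : 0 < t₁)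
    (S : ℝ → ℝ) :
    trackingCost P Y t₁ T S
      = ∫⁻ t in Icc t₁ T, ENNReal.ofReal (varOUP κ σ t + (S t - meanOUP κ y₀ μ t) ^ 2) := by
  refine setLIntegral_congr_fun measurableSet_Icc fun t ht => ?_
  exact lintegral_sq_sub_gaussian (varOUP_pos hκ hσ (ht₁.trans_le ht.1))
    (hY.hasLaw hW hκ hμ ⟨ht₁.le.trans ht.1, ht.2⟩) _

theorem chance_iff (hW : IsBrownianReal W P) (hκ : 0 < κ) (hσ : 0 < σ)
    (hμ : IntegrableOn μ (Icc 0 T)) (hY : IsOUProcess P W κ σ y₀ μ T Y) (hθ0 : 0 < θ)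
    (hθ1 : θ < 1) {t : ℝ} (ht : 0 < t) (htT : t ≤ T) (c : ℝ) :
    ENNReal.ofReal (1 - θ) ≤ P {w | Y t w ≤ c} ↔ quantileBound κ σ y₀ μ θ t ≤ c :=
  ofReal_le_measure_le_iff (varOUP_pos hκ hσ ht) (hY.hasLaw hW hκ hμ ⟨ht.le, htT⟩)
    (by linarith) (by linarith) c

/-- This is where `θ ≤ 1/2` matters: the normal quantile is nonnegative at levels of at least one
half. -/
theorem meanOUP_le_quantileBound (hθ0 : 0 < θ) (hθ : θ ≤ 1 / 2) (t : ℝ) :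
    meanOUP κ y₀ μ t ≤ quantileBound κ σ y₀ μ θ t :=
  le_add_of_nonneg_right (mul_nonneg (Real.sqrt_nonneg _)
    (stdNormalQuantile_nonneg (by linarith) (by linarith)))

/-- Above the quantile bound, the tracking cost is minimal at the quantile bound. -/
theorem trackingCost_mono (hW : IsBrownianReal W P) (hκ : 0 < κ) (hσ : 0 < σ)
    (hμ : IntegrableOn μ (Icc 0 T)) (hY : IsOUProcess P W κ σ y₀ μ T Y) (ht₁ : 0 < t₁)
    (hθ0 : 0 < θ) (hθ : θ ≤ 1 / 2) (hS : ∀ t ∈ Icc t₁ T, quantileBound κ σ y₀ μ θ t ≤ S t) :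
    trackingCost P Y t₁ T (quantileBound κ σ y₀ μ θ) ≤ trackingCost P Y t₁ T S := by
  rw [trackingCost_eq hW hκ hσ hμ hY ht₁, trackingCost_eq hW hκ hσ hμ hY ht₁]
  refine setLIntegral_mono' measurableSet_Icc fun t ht => ENNReal.ofReal_le_ofReal ?_
  have h1 := meanOUP_le_quantileBound (κ := κ) (σ := σ) (y₀ := y₀) (μ := μ) hθ0 hθ t
  have h2 := hS t ht
  gcongr

/-- The quantile bound is the only minimizer of the tracking cost above the quantile bound. -/
theorem ae_eq_quantileBound_of_trackingCost_le (hW : IsBrownianReal W P) (hκ : 0 < κ)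
    (hσ : 0 < σ) (hμ : IntegrableOn μ (Icc 0 T)) (hY : IsOUProcess P W κ σ y₀ μ T Y)
    (ht₁ : 0 < t₁) (hθ0 : 0 < θ) (hθ : θ ≤ 1 / 2)
    (hS : ∀ t ∈ Icc t₁ T, quantileBound κ σ y₀ μ θ t ≤ S t)
    (hSm : AEMeasurable S (volume.restrict (Icc t₁ T)))
    (hle : trackingCost P Y t₁ T S ≤ trackingCost P Y t₁ T (quantileBound κ σ y₀ μ θ)) :
    ∀ᵐ t ∂(volume.restrict (Icc t₁ T)), S t = quantileBound κ σ y₀ μ θ t := by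
  rw [trackingCost_eq hW hκ hσ hμ hY ht₁, trackingCost_eq hW hκ hσ hμ hY ht₁] at hle
  have hsub : Icc t₁ T ⊆ Icc 0 T := Icc_subset_Icc_left ht₁.le
  have hmc := (continuousOn_meanOUP (κ := κ) (y₀ := y₀) hμ).mono hsub
  have hqc := (continuousOn_quantileBound (κ := κ) (σ := σ) (y₀ := y₀) hμ θ).mono hsub
  have hvc := (continuous_varOUP κ σ).continuousOn (s := Icc t₁ T)
  have hmono : ∀ t ∈ Icc t₁ T, 0 ≤ quantileBound κ σ y₀ μ θ t - meanOUP κ y₀ μ t ∧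
      quantileBound κ σ y₀ μ θ t - meanOUP κ y₀ μ t ≤ S t - meanOUP κ y₀ μ t := fun t ht =>
    ⟨sub_nonneg.2 (meanOUP_le_quantileBound hθ0 hθ t), sub_le_sub_right (hS t ht) _⟩
  -- Ordered integrands with reversed order of integrals agree almost everywhere, provided the
  -- smaller integral is finite; continuity on a compact interval ensures that.
  have hae := ae_eq_of_ae_le_of_lintegral_le (μ := volume.restrict (Icc t₁ T))
    (f := fun t => ENNReal.ofReal
      (varOUP κ σ t + (quantileBound κ σ y₀ μ θ t - meanOUP κ y₀ μ t) ^ 2))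
    (g := fun t => ENNReal.ofReal (varOUP κ σ t + (S t - meanOUP κ y₀ μ t) ^ 2))
    ?_ ?_ ?_ hle
  · filter_upwards [hae, ae_restrict_mem measurableSet_Icc] with t ht htI
    have hv := (varOUP_pos hκ hσ (ht₁.trans_le htI.1)).le
    rw [ENNReal.ofReal_eq_ofReal_iff (by positivity) (by positivity)] at ht
    obtain ⟨h0, h1⟩ := hmono t htI
    have := (sq_eq_sq₀ h0 (h0.trans h1)).1 (by linarith)
    linarith
  · filter_upwards [ae_restrict_mem measurableSet_Icc] with t ht
    obtain ⟨h0, h1⟩ := hmono t ht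
    refine ENNReal.ofReal_le_ofReal ?_
    gcongr
  · exact ((hvc.add ((hqc.sub hmc).pow 2)).integrableOn_Icc.lintegral_lt_top).ne
  · have hm := hmc.aemeasurable (μ := volume) measurableSet_Icc
    have hv := hvc.aemeasurable (μ := volume) measurableSet_Icc
    exact (hv.add ((hSm.sub hm).pow_const 2)).ennreal_ofReal

end OUP

/-- Inflow after `T - b / lam` does not reach the node before `T`, so extension by zero is harmless;
continuity on the compact interval gives square integrability. -/
theorem isAdmissible_indicator_optimalInflow {lam s b κ σ y₀ θ T : ℝ} {μ : ℝ → ℝ}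
    (hlam : 0 < lam) (hb : 0 < b) (hμ : IntegrableOn μ (Icc 0 T))
    (hpos : ∀ t ∈ Icc (b / lam) T, 0 ≤ quantileBound κ σ y₀ μ θ t) :
    IsAdmissible T ((Icc 0 (T - b / lam)).indicator (optimalInflow lam s b κ σ y₀ μ θ)) where
  memLp := by
    have hbl : 0 < b / lam := div_pos hb hlam
    have hc : ContinuousOn (optimalInflow lam s b κ σ y₀ μ θ) (Icc 0 (T - b / lam)) := by
      refine continuousOn_const.mul ((continuousOn_quantileBound hμ θ).comp (by fun_prop) ?_)
      exact fun t ht => ⟨by linarith [ht.1], by linarith [ht.2]⟩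
    obtain ⟨C, hC⟩ := isCompact_Icc.exists_bound_of_continuousOn hc
    refine MemLp.restrict _ ((memLp_indicator_iff_restrict measurableSet_Icc).2 ?_)
    refine MemLp.of_bound (hc.aestronglyMeasurable measurableSet_Icc) C ?_
    filter_upwards [ae_restrict_mem measurableSet_Icc] with t ht using hC t ht
  nonneg t _ := indicator_nonneg (fun τ hτ => mul_nonneg (Real.exp_pos _).le
    (hpos _ ⟨by linarith [hτ.1], by linarith [hτ.2]⟩)) t

theorem IsAdmissible.integrableOn {T : ℝ} {u : ℝ → ℝ} (hu : IsAdmissible T u) :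
    IntegrableOn u (Icc 0 T) :=
  hu.memLp.integrable one_le_two

/-- An admissible control that agrees with the closed form is feasible, with a supply that equals
the quantile bound from the transport delay on. -/
theorem exists_isFeasible [IsProbabilityMeasure P] {W : ℝ≥0 → Ω → ℝ} (hW : IsBrownianReal W P)
    {lam s b T : ℝ} (hlam : 0 < lam) (hb : 0 < b)
    {ρ₀ : ℝ → ℝ} (hρ₀ : IntegrableOn ρ₀ (Icc 0 b))
    {κ σ y₀ : ℝ} (hκ : 0 < κ) (hσ : 0 < σ) {μ : ℝ → ℝ} (hμ : IntegrableOn μ (Icc 0 T))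
    {Y : ℝ → Ω → ℝ} (hY : IsOUProcess P W κ σ y₀ μ T Y)
    {θ : ℝ} (hθ0 : 0 < θ) (hθ : θ ≤ 1 / 2) {I : Set ℝ} (hIT : I ⊆ Icc 0 T)
    (hinit : ∀ᵐ t : ℝ, t ∈ I → t < b / lam →
      ENNReal.ofReal (1 - θ) ≤ P {w | Y t w ≤ Real.exp (s * t) * ρ₀ (b - lam * t)})
    {u : ℝ → ℝ} (hu : IsAdmissible T u)
    (huq : ∀ᵐ t ∂(volume.restrict (Icc 0 (T - b / lam))),
      u t = optimalInflow lam s b κ σ y₀ μ θ t) :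
    ∃ S, IsFeasible P Y lam s b T ρ₀ θ I u S ∧
      ∀ t, b / lam ≤ t → S t = quantileBound κ σ y₀ μ θ t := by
  classical
  have hbl : 0 < b / lam := div_pos hb hlam
  choose c hc using fun t => exists_ofReal_le_measure_le (P := P) (Y t) (by linarith : 1 - θ < 1)
  -- A representative meeting the constraint at every time of `I`: the quantile bound once the
  -- inflow arrives, the transported initial state before, and `c t` on the null set where the
  -- latter fails.
  set S : ℝ → ℝ := fun t =>
    if b / lam ≤ t then quantileBound κ σ y₀ μ θ t
    else if t ∈ I → ENNReal.ofReal (1 - θ) ≤ P {w | Y t w ≤ Real.exp (s * t) * ρ₀ (b - lam * t)}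
      then Real.exp (s * t) * ρ₀ (b - lam * t) else c t with hS
  have hSq : ∀ t, b / lam ≤ t → S t = quantileBound κ σ y₀ μ θ t := fun t ht => if_pos ht
  refine ⟨S, ⟨hu, isSupply_of_ae_eq hlam hb hρ₀ hu.integrableOn ?_, fun t ht => ?_⟩, hSq⟩
  · rw [ae_restrict_iff' measurableSet_Icc] at huq
    have hshift := (measurePreserving_sub_right volume (b / lam)).quasiMeasurePreserving.ae huq
    rw [Filter.EventuallyEq, ae_restrict_iff' measurableSet_Icc]
    filter_upwards [hshift, hinit] with t ht hti htT
    rcases le_or_gt (b / lam) t with h | h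
    · rw [hSq t h, characteristicOutflow_of_le hlam hb h htT.2,
        ht ⟨by linarith, by linarith [htT.2]⟩, optimalInflow, ← mul_assoc, ← Real.exp_add]
      simp
    · rw [characteristicOutflow_of_lt hlam htT.1 h, hS]
      simp only [if_neg (not_le.2 h), if_pos fun hI => hti hI h]
  · rcases le_or_gt (b / lam) t with h | h
    · rw [hSq t h]
      exact (chance_iff hW hκ hσ hμ hY hθ0 (by linarith) (hbl.trans_le h) (hIT ht).2 _).2 le_rfl
    · simp only [hS, if_neg (not_le.2 h)]
      split_ifs with hif
      · exact hif ht
      · exact hc t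

end SupplyControl

/-! ### The optimal control. -/

theorem mainTheorem1
    {Ω : Type*} [MeasurableSpace Ω] (P : Measure Ω) [IsProbabilityMeasure P]
    (W : ℝ≥0 → Ω → ℝ) (hW : IsBrownianReal W P)
    (lam s b T : ℝ) (hlam : 0 < lam) (hb : 0 < b) (hT : b / lam ≤ T)
    (ρ₀ : ℝ → ℝ) (hρ₀ : IntegrableOn ρ₀ (Icc 0 b))
    (κ σ y₀ : ℝ) (hκ : 0 < κ) (hσ : 0 < σ)
    (μ : ℝ → ℝ) (hμ : IntegrableOn μ (Icc 0 T))
    (Y : ℝ → Ω → ℝ) (hY : SupplyControl.IsOUProcess P W κ σ y₀ μ T Y)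
    (θ : ℝ) (hθ0 : 0 < θ) (hθ : θ ≤ 1 / 2)
    -- the chance constraint is active at all times at which the control can act
    (I : Set ℝ) (hI : Icc (b / lam) T ⊆ I) (hIT : I ⊆ Icc 0 T)
    -- wherever it is also imposed before the inflow reaches the demand node, the outflow of the
    -- initial state satisfies it (void for `I = Icc (b / lam) T`)
    (hinit : ∀ᵐ t : ℝ, t ∈ I → t < b / lam →
      ENNReal.ofReal (1 - θ) ≤ P {w | Y t w ≤ Real.exp (s * t) * ρ₀ (b - lam * t)})
    -- the quantile bound respects the lower bound `0` on the control
    (hpos : ∀ t ∈ Icc (b / lam) T, 0 ≤ SupplyControl.quantileBound κ σ y₀ μ θ t) :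
    (∃ u : ℝ → ℝ, SupplyControl.IsOptimalControl P Y lam s b T ρ₀ θ I u ∧
      ∀ t ∈ Icc 0 (T - b / lam), u t = SupplyControl.optimalInflow lam s b κ σ y₀ μ θ t) ∧
    (∀ u : ℝ → ℝ, SupplyControl.IsOptimalControl P Y lam s b T ρ₀ θ I u ↔
      SupplyControl.IsAdmissible T u ∧
      ∀ᵐ t ∂(volume.restrict (Icc 0 (T - b / lam))),
        u t = SupplyControl.optimalInflow lam s b κ σ y₀ μ θ t) := by
  have hbl : 0 < b / lam := div_pos hb hlam
  have hq : ∀ u S, SupplyControl.IsFeasible P Y lam s b T ρ₀ θ I u S →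
      ∀ t ∈ Icc (b / lam) T, SupplyControl.quantileBound κ σ y₀ μ θ t ≤ S t := fun u S h t ht =>
    (SupplyControl.chance_iff hW hκ hσ hμ hY hθ0 (by linarith) (hbl.trans_le ht.1) ht.2 _).1
      (h.chance t (hI ht))
  have hcost : ∀ {S : ℝ → ℝ},
      (∀ t, b / lam ≤ t → S t = SupplyControl.quantileBound κ σ y₀ μ θ t) →
      SupplyControl.trackingCost P Y (b / lam) T S = SupplyControl.trackingCost P Y (b / lam) T
        (SupplyControl.quantileBound κ σ y₀ μ θ) := fun {S} hS =>
    setLIntegral_congr_fun measurableSet_Icc fun t ht => by simp only [hS t ht.1]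
  have hiff : ∀ u : ℝ → ℝ, SupplyControl.IsOptimalControl P Y lam s b T ρ₀ θ I u ↔
      SupplyControl.IsAdmissible T u ∧ ∀ᵐ t ∂(volume.restrict (Icc 0 (T - b / lam))),
        u t = SupplyControl.optimalInflow lam s b κ σ y₀ μ θ t := by
    intro u
    constructor
    · rintro ⟨S, hS, hmin⟩
      refine ⟨hS.admissible, ?_⟩
      -- The closed form extended by zero is a competitor that attains the lower bound, so an
      -- optimal `S` must attain it too.
      obtain ⟨S₀, hS₀, hS₀q⟩ := SupplyControl.exists_isFeasible hW hlam hb hρ₀ hκ hσ hμ hY hθ0 hθ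
        hIT hinit (SupplyControl.isAdmissible_indicator_optimalInflow (s := s) hlam hb hμ hpos)
        (by
          filter_upwards [ae_restrict_mem measurableSet_Icc] with t ht
          exact indicator_of_mem ht _)
      obtain ⟨ρ, hρ⟩ := hS.supply
      have hSq := SupplyControl.ae_eq_quantileBound_of_trackingCost_le hW hκ hσ hμ hY hbl hθ0 hθ
        (hq u S hS) (hρ.integrableOn_outflow.mono_set (Icc_subset_Icc_left hbl.le)).aemeasurable
        ((hmin _ _ hS₀).trans_eq (hcost hS₀q))
      rw [ae_restrict_iff' measurableSet_Icc] at hSq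
      have hshift :=
        (measurePreserving_add_right volume (b / lam)).quasiMeasurePreserving.ae hSq
      -- The delay formula is known on the open interval; the endpoints are null.
      rw [← restrict_Ioo_eq_restrict_Icc, ae_restrict_iff' measurableSet_Ioo]
      filter_upwards [hshift, hρ.outflow_ae_eq hlam hb hS.admissible.integrableOn] with τ h1 h2 hτ
      have h3 := h2 hτ
      rw [h1 ⟨by linarith [hτ.1], by linarith [hτ.2]⟩] at h3
      rw [SupplyControl.optimalInflow]
      linarith
    · rintro ⟨hu, huq⟩
      obtain ⟨S, hS, hSq⟩ := SupplyControl.exists_isFeasible hW hlam hb hρ₀ hκ hσ hμ hY hθ0 hθ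
        hIT hinit hu huq
      refine ⟨S, hS, fun u' S' h' => ?_⟩
      rw [hcost hSq]
      exact SupplyControl.trackingCost_mono hW hκ hσ hμ hY hbl hθ0 hθ (hq u' S' h')
  refine ⟨⟨(Icc 0 (T - b / lam)).indicator (SupplyControl.optimalInflow lam s b κ σ y₀ μ θ),
    (hiff _).2 ⟨SupplyControl.isAdmissible_indicator_optimalInflow hlam hb hμ hpos, ?_⟩,
    fun t ht => indicator_of_mem ht _⟩, hiff⟩
  filter_upwards [ae_restrict_mem measurableSet_Icc] with t ht
  exact indicator_of_mem ht _
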